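/- All functions are (equivalence classes of) complex-valued measurable functions on $[0,1]$ with Lebesgue measure, and $f^*$, $(c_k^*)_{k\ge1}$ denote the non-increasing rearrangements of $|f|$ and of $(|c_n|)$. For $0<p,q\le\infty$ and $\beta\in\mathbb R$ (with $1/\infty=0$) let $L_{p,q}(\log L)_\beta$ and $l_{p,q}(\log l)_\beta$ be the spaces of those $f$ and those $(c_n)$ for which, respectively, $$\|f\|_{L_{p,q}(\log L)_\beta}=\big\|t^{1/p-1/q}(1+|\log t|)^\beta f^*(t)\big\|_{L_q(0,1)}<\infty,\qquad \|(c_n)\|_{l_{p,q}(\log l)_\beta}=\big\|\big(k^{1/p-1/q}(1+\log k)^\beta c_k^*\big)_{k\ge1}\big\|_{l_q}<\infty.$$ The intersection of two such spaces carries the maximum of the two quasi-norms. **Corollary 3.6.** Let $0<q\le\infty$ and $\alpha<-1/q$. There is a constant $C>0$ depending only on $q$ and $\alpha$ such that the following holds. Let $\{\varphi_n\}$ be an orthonormal system in $L_2(0,1)$, indexed by a countably infinite set (such as $\mathbb N$ or $\mathbb Z$), with $\sup_n\|\varphi_n\|_{L_\infty}=M<\infty$, and let $\mathcal F(f)=\{c_n(f)\}$,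 $c_n(f)=\int_0^1 f(x)\overline{\varphi_n(x)}\,dx$. Then every $f\in L_{2,q}(\log L)_{\alpha+1/\min(q,2)}$ is integrable, and $\mathcal F$ is bounded from $L_{2,q}(\log L)_{\alpha+1/\min(q,2)}$ into $l_{2,q}(\log l)_{\alpha+1/\max(q,2)}\cap l_{2,\max(q,2)}(\log l)_{\alpha+1/q}$ with $$\big\|\mathcal F : L_{2,q}(\log L)_{\alpha+1/\min(q,2)}\to l_{2,q}(\log l)_{\alpha+1/\max(q,2)}\cap l_{2,\max(q,2)}(\log l)_{\alpha+1/q}\big\|\le C\,\min\big(M,(1+\log M)^{|\alpha|}\big).$$ -/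

import Mathlib

open MeasureTheory Set
open scoped ENNReal NNReal

/-- Lebesgue measure on the interval `[0, 1]`. -/
noncomputable def unitVolume : Measure ℝ := volume.restrict (Icc (0 : ℝ) 1)

/-- The non-increasing rearrangement `f^*(t) = inf {s ≥ 0 : |{x ∈ [0,1] : |f x| > s}| ≤ t}` of
(the class of) a measurable function on `[0, 1]`. -/
noncomputable def funRearr (f : ℝ →ₘ[unitVolume] ℂ) (t : ℝ) : ℝ≥0∞ :=
  sInf {s : ℝ≥0∞ | unitVolume {x | s < ‖f x‖ₑ} ≤ ENNReal.ofReal t}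

/-- The non-increasing rearrangement of a family of complex numbers, for `k = 1, 2, …`:
`c_k^* = inf {s ≥ 0 : fewer than k indices n satisfy |c n| > s}`. -/
noncomputable def seqRearr {ι : Type} (c : ι → ℂ) (k : ℕ) : ℝ≥0∞ :=
  sInf {s : ℝ≥0∞ | {n | s < ‖c n‖ₑ}.encard < (k : ℕ∞)}

/-- The reciprocal of an exponent in `(0, ∞]`, as a real number; `1 / ∞ = 0`. -/
noncomputable def recip (q : ℝ≥0∞) : ℝ := (q⁻¹).toReal

/-- The quasi-norm of `L_{p,q}(log L)_α`, that is
`‖ t^{1/p - 1/q} (1 + |log t|)^α f^*(t) ‖` in `L_q(0, 1)` (it may be infinite). -/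
noncomputable def lzFunNorm (p q : ℝ≥0∞) (α : ℝ) (f : ℝ →ₘ[unitVolume] ℂ) : ℝ≥0∞ :=
  eLpNorm (fun t : ℝ => ENNReal.ofReal (t ^ (recip p - recip q) * (1 + |Real.log t|) ^ α)
    * funRearr f t) q (volume.restrict (Ioo (0 : ℝ) 1))

/-- The Lorentz–Zygmund function space `L_{p,q}(log L)_α`. -/
def LZFun (p q : ℝ≥0∞) (α : ℝ) : Set (ℝ →ₘ[unitVolume] ℂ) := {f | lzFunNorm p q α f < ∞}

/-- The quasi-norm of `l_{p,q}(log l)_α`, that is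
`‖ k^{1/p - 1/q} (1 + log k)^α c_k^* ‖` in `l_q`, `k = 1, 2, …` (it may be infinite);
the summation variable below is `j = k - 1`. -/
noncomputable def lzSeqNorm {ι : Type} (p q : ℝ≥0∞) (α : ℝ) (c : ι → ℂ) : ℝ≥0∞ :=
  eLpNorm (fun j : ℕ => ENNReal.ofReal (((j + 1 : ℕ) : ℝ) ^ (recip p - recip q)
    * (1 + Real.log ((j + 1 : ℕ) : ℝ)) ^ α) * seqRearr c (j + 1)) q Measure.count

/-- The Lorentz–Zygmund sequence space `l_{p,q}(log l)_α`. A family in it is automatically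
bounded, since `c_1^* = sup |c n|` carries a positive weight. -/
def LZSeq (ι : Type) (p q : ℝ≥0∞) (α : ℝ) : Set (ι → ℂ) := {c | lzSeqNorm p q α c < ∞}

/-- The Fourier series map `f ↦ (c_n(f))`, `c_n(f) = ∫_0^1 f(x) conj(φ_n(x)) dx`. -/
noncomputable def fourierMap {ι : Type} (φ : ι → Lp ℂ 2 unitVolume)
    (f : ℝ →ₘ[unitVolume] ℂ) : ι → ℂ :=
  fun n => ∫ x, f x * (starRingEnd ℂ) (φ n x) ∂unitVolume

/-! Put g_m = 2^{-m/2} f^*(2^{-m}) (`dyadicRearr`) and cut f at the level f^*(2^{-J}). The lower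
part f_0 satisfies ‖f_0‖_2^2 ≤ 2 Σ_{m≤J} g_m^2, and Bessel's inequality controls its coefficients in
ℓ^2. The upper part f_1 satisfies ‖f_1‖_1 ≤ 2 Σ_{m>J} 2^{-m/2} g_m, and each of its coefficients is
at most M‖f_1‖_1. So Σ_{k≤N} (c_k^*)^2 ≤ 2‖f_0‖_2^2 + 2N M^2 ‖f_1‖_1^2 (`sum_sq_fourierMap_le`).

Take N = 2^{2^{i+1}}, M ≤ 2^{2^j/2} and J of order 2^{i+j+3}. Then √N·M is absorbed by half of the
decay 2^{-m/2} in the tail, and the partial ℓ^2 norm of c^* up to N is at most 6 times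
(Σ_{m<2^{i+j+3}-1} g_m^2)^{1/2} + Σ 2^{-m/4} g_m (`sqrt_sum_sq_fourierMap_le`).

Both quasi-norms are then compared with the ℓ^q norm over i of 2^{iβ} times partial ℓ^2 norms, where
β = α + 1/q < 0. On the function side the geometric decay reduces partial sums to single blocks m+1
~ 2^r (a Hardy inequality), and comparing ℓ^2 with ℓ^q on a block produces the exponent α +
1/min(q,2) (`lqNorm_partial_sqrt_le`). On the sequence side 1 + log k ~ 2^i on doubly exponential
blocks, which produces α + 1/max(q,2) (`lzSeqNorm_le`). The shift by j+3 costs 2^{-(j+3)β}, at most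
a constant times (1 + log M)^{|α|}; as this is itself O(M), the minimum comes for free. -/

/-! ### The `ℓ^q` quasi-norm of sequences in `[0, ∞]` -/

/-- The `ℓ^q` quasi-norm of a sequence of extended nonnegative reals. -/
noncomputable def lqNorm (q : ℝ≥0∞) (x : ℕ → ℝ≥0∞) : ℝ≥0∞ := eLpNorm x q Measure.count

theorem lqNorm_eq_tsum {q : ℝ≥0∞} (h0 : q ≠ 0) (ht : q ≠ ∞) (x : ℕ → ℝ≥0∞) :
    lqNorm q x = (∑' n, x n ^ q.toReal) ^ (1 / q.toReal) := by
  rw [lqNorm, eLpNorm_eq_lintegral_rpow_enorm_toReal h0 ht, lintegral_count]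
  simp

theorem lqNorm_rpow {q : ℝ≥0∞} (h0 : q ≠ 0) (ht : q ≠ ∞) (x : ℕ → ℝ≥0∞) :
    lqNorm q x ^ q.toReal = ∑' n, x n ^ q.toReal := by
  rw [lqNorm_eq_tsum h0 ht, ← ENNReal.rpow_mul, one_div_mul_cancel, ENNReal.rpow_one]
  exact (ENNReal.toReal_pos h0 ht).ne'

theorem lqNorm_top (x : ℕ → ℝ≥0∞) : lqNorm ∞ x = ⨆ n, x n := by
  rw [lqNorm, eLpNorm_exponent_top, eLpNormEssSup, essSup_count]
  simp

theorem lqNorm_mono {q : ℝ≥0∞} {x y : ℕ → ℝ≥0∞} (h : ∀ n, x n ≤ y n) :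
    lqNorm q x ≤ lqNorm q y :=
  eLpNorm_mono_enorm (by simpa using h)

theorem le_of_rpow_le {a b : ℝ≥0∞} {p : ℝ} (hp : 0 < p) (h : a ^ p ≤ b ^ p) : a ≤ b :=
  (ENNReal.rpow_le_rpow_iff hp).1 h

theorem lqNorm_const_mul {q : ℝ≥0∞} (h0 : q ≠ 0) (c : ℝ≥0∞) (x : ℕ → ℝ≥0∞) :
    lqNorm q (fun n => c * x n) = c * lqNorm q x := by
  by_cases ht : q = ∞
  · subst ht
    rw [lqNorm_top, lqNorm_top, ENNReal.mul_iSup]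
  · have hp := ENNReal.toReal_pos h0 ht
    rw [lqNorm_eq_tsum h0 ht, lqNorm_eq_tsum h0 ht]
    simp_rw [ENNReal.mul_rpow_of_nonneg _ _ hp.le]
    rw [ENNReal.tsum_mul_left, ENNReal.mul_rpow_of_nonneg _ _ (by positivity), ← ENNReal.rpow_mul,
      mul_one_div_cancel hp.ne', ENNReal.rpow_one]

theorem le_lqNorm {q : ℝ≥0∞} (h0 : q ≠ 0) (x : ℕ → ℝ≥0∞) (n : ℕ) : x n ≤ lqNorm q x := by
  by_cases ht : q = ∞
  · subst ht
    rw [lqNorm_top]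
    exact le_iSup x n
  · refine le_of_rpow_le (ENNReal.toReal_pos h0 ht) ?_
    rw [lqNorm_rpow h0 ht]
    exact ENNReal.le_tsum n

theorem lqNorm_add_le (q : ℝ≥0∞) (x y : ℕ → ℝ≥0∞) :
    lqNorm q (fun n => x n + y n) ≤ ENNReal.LpAddConst q * (lqNorm q x + lqNorm q y) :=
  eLpNorm_add_le' (f := x) (g := y) (Measurable.of_discrete.aestronglyMeasurable)
    (Measurable.of_discrete.aestronglyMeasurable) q

theorem lqNorm_shift_le {q : ℝ≥0∞} (h0 : q ≠ 0) (x : ℕ → ℝ≥0∞) (j : ℕ) :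
    lqNorm q (fun n => x (n + j)) ≤ lqNorm q x := by
  by_cases ht : q = ∞
  · subst ht
    rw [lqNorm_top, lqNorm_top]
    exact iSup_le fun n => le_iSup x (n + j)
  · refine le_of_rpow_le (ENNReal.toReal_pos h0 ht) ?_
    rw [lqNorm_rpow h0 ht, lqNorm_rpow h0 ht]
    exact ENNReal.tsum_comp_le_tsum_of_injective (add_left_injective j) (fun n => x n ^ q.toReal)

theorem rpow_sum_le_sum_rpow {ι : Type*} (s : Finset ι) (x : ι → ℝ≥0∞) {p : ℝ} (h0 : 0 < p)
    (h1 : p ≤ 1) : (∑ i ∈ s, x i) ^ p ≤ ∑ i ∈ s, x i ^ p := by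
  classical
  induction s using Finset.induction_on with
  | empty => simp [h0]
  | insert a s ha ih =>
    rw [Finset.sum_insert ha, Finset.sum_insert ha]
    exact (ENNReal.rpow_add_le_add_rpow _ _ h0.le h1).trans (by gcongr)

theorem rpow_tsum_le_tsum_rpow (x : ℕ → ℝ≥0∞) {p : ℝ} (h0 : 0 < p)
    (h1 : p ≤ 1) : (∑' i, x i) ^ p ≤ ∑' i, x i ^ p := by
  rw [← ENNReal.le_rpow_inv_iff h0]
  refine ENNReal.tsum_le_of_sum_range_le fun n => ?_
  rw [ENNReal.le_rpow_inv_iff h0]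
  exact (rpow_sum_le_sum_rpow _ _ h0 h1).trans (ENNReal.sum_le_tsum _)

theorem lqNorm_anti_exponent {p q : ℝ≥0∞} (h0 : q ≠ 0) (hqp : q ≤ p) (ht : p ≠ ∞)
    (x : ℕ → ℝ≥0∞) : lqNorm p x ≤ lqNorm q x := by
  have hqt : q ≠ ∞ := ne_top_of_le_ne_top ht hqp
  have hp0 : p ≠ 0 := fun h => h0 (by simpa [h] using hqp)
  have hq := ENNReal.toReal_pos h0 hqt
  have hp := ENNReal.toReal_pos hp0 ht
  refine le_of_rpow_le hq ?_
  rw [lqNorm_rpow h0 hqt, lqNorm_eq_tsum hp0 ht, ← ENNReal.rpow_mul]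
  refine (rpow_tsum_le_tsum_rpow _ (by positivity) ?_).trans (le_of_eq ?_)
  · rw [one_div, inv_mul_le_iff₀ hp, mul_one]
    exact (ENNReal.toReal_le_toReal hqt ht).2 hqp
  · congr 1 with i
    rw [← ENNReal.rpow_mul]
    congr 1
    field_simp

/-! ### Summation over consecutive blocks -/

theorem sum_blocks (N : ℕ → ℕ) (hN : StrictMono N) (h0 : N 0 = 0) (x : ℕ → ℝ≥0∞) (i : ℕ) :
    ∑ r ∈ Finset.range i, ∑ m ∈ Finset.Ico (N r) (N (r + 1)), x m
      = ∑ m ∈ Finset.range (N i), x m := by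
  induction i with
  | zero => simp [h0]
  | succ i ih =>
    rw [Finset.sum_range_succ, ih, Finset.range_eq_Ico, Finset.range_eq_Ico,
      Finset.sum_Ico_consecutive _ (Nat.zero_le _) (hN.monotone (Nat.le_succ i))]

theorem tsum_blocks (N : ℕ → ℕ) (hN : StrictMono N) (h0 : N 0 = 0) (x : ℕ → ℝ≥0∞) :
    ∑' r, ∑ m ∈ Finset.Ico (N r) (N (r + 1)), x m = ∑' m, x m := by
  refine le_antisymm (ENNReal.tsum_le_of_sum_range_le fun n => ?_)
    (ENNReal.tsum_le_of_sum_range_le fun n => ?_)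
  · rw [sum_blocks N hN h0]
    exact ENNReal.sum_le_tsum _
  · refine le_trans ?_ (ENNReal.sum_le_tsum (Finset.range n))
    rw [sum_blocks N hN h0]
    exact Finset.sum_le_sum_of_subset (Finset.range_mono hN.le_apply)

theorem exists_mem_block (N : ℕ → ℕ) (hN : StrictMono N) (h0 : N 0 = 0) (m : ℕ) :
    ∃ r, m ∈ Finset.Ico (N r) (N (r + 1)) := by
  have hex : ∃ r, m < N (r + 1) := ⟨m, (Nat.lt_succ_self m).trans_le hN.le_apply⟩
  classical
  refine ⟨Nat.find hex, Finset.mem_Ico.2 ⟨?_, Nat.find_spec hex⟩⟩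
  rcases h : Nat.find hex with _ | r
  · simp [h0]
  · exact not_lt.1 (Nat.find_min hex (h ▸ Nat.lt_succ_self r))

/-! ### Convolution with geometric sequences -/

theorem tsum_conv (a b : ℕ → ℝ≥0∞) :
    ∑' i, ∑ r ∈ Finset.range (i + 1), a (i - r) * b r = (∑' j, a j) * ∑' r, b r := by
  have h1 : ∀ i, ∑ r ∈ Finset.range (i + 1), a (i - r) * b r
      = ∑ p ∈ Finset.HasAntidiagonal.antidiagonal i, b p.1 * a p.2 := fun i => by
    rw [Finset.Nat.sum_antidiagonal_eq_sum_range_succ (fun k l => b k * a l)]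
    simp_rw [mul_comm]
  simp_rw [h1]
  have h2 : ∀ i, ∑ p ∈ Finset.HasAntidiagonal.antidiagonal i, b p.1 * a p.2
      = ∑' p : Finset.HasAntidiagonal.antidiagonal i, b p.1.1 * a p.1.2 := fun i => by
    rw [tsum_fintype, Finset.sum_coe_sort (Finset.HasAntidiagonal.antidiagonal i) (fun p => b p.1 * a p.2)]
  simp_rw [h2]
  rw [← ENNReal.tsum_sigma' (fun p : Σ i, Finset.HasAntidiagonal.antidiagonal i => b p.2.1.1 * a p.2.1.2)]
  refine (Finset.HasAntidiagonal.sigmaAntidiagonalEquivProd.tsum_eq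
    (fun p : ℕ × ℕ => b p.1 * a p.2)).trans ?_
  rw [ENNReal.tsum_prod', ENNReal.tsum_comm]
  simp_rw [ENNReal.tsum_mul_right, ENNReal.tsum_mul_left]
  rw [mul_comm]

theorem tsum_geometric_ne_top {θ : ℝ≥0∞} (h : θ < 1) : ∑' n : ℕ, θ ^ n ≠ ∞ := by
  rw [ENNReal.tsum_geometric]
  exact ENNReal.inv_ne_top.2 (tsub_pos_of_lt h).ne'

/-- Convolution with a geometric sequence is bounded in `ℓ^q` for every `q > 0`. -/
theorem lqNorm_geometric_conv_le {q : ℝ≥0∞} (h0 : q ≠ 0) {θ : ℝ≥0∞} (hθ : θ < 1) :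
    ∃ C : ℝ≥0∞, C ≠ ∞ ∧ ∀ x : ℕ → ℝ≥0∞,
      lqNorm q (fun i => ∑ r ∈ Finset.range (i + 1), θ ^ (i - r) * x r) ≤ C * lqNorm q x := by
  -- Minkowski's inequality fails for q < 1. With θ = ρ², one factor ρ sums the series and the other
  -- stays inside a maximum, whose q-th power is at most the sum of the q-th powers.
  set ρ : ℝ≥0∞ := θ ^ (1 / 2 : ℝ) with hρ
  have hρ1 : ρ < 1 := ENNReal.rpow_lt_one hθ (by norm_num)
  have hρρ : ρ * ρ = θ := by
    rw [hρ, ← ENNReal.rpow_add_of_nonneg _ _ (by norm_num) (by norm_num)]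
    norm_num
  clear_value ρ
  set S := ∑' n : ℕ, ρ ^ n with hS
  have hSt : S ≠ ∞ := tsum_geometric_ne_top hρ1
  have key : ∀ (x : ℕ → ℝ≥0∞) (i : ℕ), ∃ r ∈ Finset.range (i + 1),
      ∑ r ∈ Finset.range (i + 1), θ ^ (i - r) * x r ≤ S * (ρ ^ (i - r) * x r) := fun x i => by
    obtain ⟨r, hr, hmax⟩ := Finset.exists_max_image (Finset.range (i + 1))
      (fun r => ρ ^ (i - r) * x r) ⟨0, by simp⟩
    refine ⟨r, hr, ?_⟩
    calc ∑ r ∈ Finset.range (i + 1), θ ^ (i - r) * x r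
        ≤ ∑ s ∈ Finset.range (i + 1), ρ ^ (i - s) * (ρ ^ (i - r) * x r) := by
          refine Finset.sum_le_sum fun s hs => ?_
          rw [← hρρ, mul_pow, mul_assoc]
          exact mul_le_mul_right (hmax s hs) _
      _ = (∑ s ∈ Finset.range (i + 1), ρ ^ (i - s)) * (ρ ^ (i - r) * x r) := by
          rw [Finset.sum_mul]
      _ ≤ S * (ρ ^ (i - r) * x r) := by
          gcongr
          have := Finset.sum_range_reflect (fun j => ρ ^ j) (i + 1)
          simp only [Nat.add_sub_cancel] at this
          rw [this]
          exact ENNReal.sum_le_tsum _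
  by_cases ht : q = ∞
  · subst ht
    refine ⟨S, hSt, fun x => ?_⟩
    rw [lqNorm_top]
    refine iSup_le fun i => ?_
    obtain ⟨r, -, h⟩ := key x i
    refine h.trans ?_
    gcongr
    calc ρ ^ (i - r) * x r ≤ 1 * x r := by gcongr; exact pow_le_one₀ zero_le hρ1.le
      _ ≤ _ := by rw [one_mul]; exact le_lqNorm (by simp) x r
  · have hp := ENNReal.toReal_pos h0 ht
    set p := q.toReal
    set R := ∑' n : ℕ, (ρ ^ p) ^ n with hR
    have hRt : R ≠ ∞ := tsum_geometric_ne_top (ENNReal.rpow_lt_one hρ1 hp)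
    refine ⟨S * R ^ (1 / p), ENNReal.mul_ne_top hSt (ENNReal.rpow_ne_top_of_nonneg (by positivity) hRt),
      fun x => le_of_rpow_le hp ?_⟩
    rw [ENNReal.mul_rpow_of_nonneg _ _ hp.le, ENNReal.mul_rpow_of_nonneg _ _ hp.le,
      ← ENNReal.rpow_mul, one_div_mul_cancel hp.ne', ENNReal.rpow_one, lqNorm_rpow h0 ht,
      lqNorm_rpow h0 ht, mul_assoc, ← tsum_conv, ← ENNReal.tsum_mul_left]
    refine ENNReal.tsum_le_tsum fun i => ?_
    obtain ⟨r, hr, h⟩ := key x i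
    refine (ENNReal.rpow_le_rpow h hp.le).trans ?_
    rw [ENNReal.mul_rpow_of_nonneg _ _ hp.le, ENNReal.mul_rpow_of_nonneg _ _ hp.le]
    gcongr
    refine le_trans (le_of_eq ?_) (Finset.single_le_sum (f := fun r => (ρ ^ p) ^ (i - r) * x r ^ p) (fun _ _ => zero_le) hr)
    rw [← ENNReal.rpow_natCast, ← ENNReal.rpow_mul, ← ENNReal.rpow_natCast, ← ENNReal.rpow_mul, mul_comm p]

/-! ### Non-increasing rearrangements -/

theorem unitVolume_univ : unitVolume univ = 1 := by
  simp [unitVolume]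

instance : IsProbabilityMeasure unitVolume := ⟨unitVolume_univ⟩

theorem funRearr_antitone (f : ℝ →ₘ[unitVolume] ℂ) : Antitone (funRearr f) := fun _ _ hst =>
  sInf_le_sInf fun _ hu => le_trans (α := ℝ≥0∞) hu (ENNReal.ofReal_le_ofReal hst)

/-- The infimum defining f^* is attained: as levels decrease to it, the superlevel sets increase,
and measure is continuous from below. -/
theorem measure_funRearr_lt_le (f : ℝ →ₘ[unitVolume] ℂ) (t : ℝ) :
    unitVolume {x | funRearr f t < ‖f x‖ₑ} ≤ ENNReal.ofReal t := by
  set S : Set ℝ≥0∞ := {s : ℝ≥0∞ | unitVolume {x | s < ‖f x‖ₑ} ≤ ENNReal.ofReal t} with hS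
  obtain ⟨u, hu, hlim, hmem⟩ := exists_seq_tendsto_sInf (S := S) ⟨∞, by simp [hS]⟩ (OrderBot.bddBelow S)
  have hEq : {x | funRearr f t < ‖f x‖ₑ} ⊆ ⋃ n, {x | u n < ‖f x‖ₑ} := fun x hx => by
    obtain ⟨n, hn⟩ := (hlim.eventually (gt_mem_nhds (show sInf S < ‖f x‖ₑ from hx))).exists
    exact mem_iUnion.2 ⟨n, hn⟩
  have hmono : Monotone fun n => {x | u n < ‖f x‖ₑ} :=
    fun m n hmn x hx => (hu hmn).trans_lt hx
  refine (measure_mono hEq).trans ?_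
  rw [hmono.measure_iUnion]
  exact iSup_le fun n => hmem n

theorem funRearr_one (f : ℝ →ₘ[unitVolume] ℂ) : funRearr f 1 = 0 := by
  refine le_antisymm (sInf_le ?_) zero_le
  simpa using (measure_mono (subset_univ _)).trans unitVolume_univ.le

theorem seqRearr_antitone {ι : Type} (c : ι → ℂ) : Antitone (seqRearr c) := fun _ _ hst =>
  sInf_le_sInf fun _ hu => lt_of_lt_of_le (α := ℕ∞) hu (by exact_mod_cast hst)

theorem le_encard_of_lt_seqRearr {ι : Type} {c : ι → ℂ} {k : ℕ} {s : ℝ≥0∞}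
    (h : s < seqRearr c k) : (k : ℕ∞) ≤ {n | s < ‖c n‖ₑ}.encard := by
  by_contra! hlt
  exact absurd (sInf_le (show s ∈ {s : ℝ≥0∞ | {n | s < ‖c n‖ₑ}.encard < (k : ℕ∞)} from hlt))
    (not_le.2 h)

theorem seqRearr_add_le {ι : Type} {c₀ c₁ : ι → ℂ} {K : ℝ≥0∞} (h : ∀ n, ‖c₁ n‖ₑ ≤ K) (k : ℕ) :
    seqRearr (fun n => c₀ n + c₁ n) k ≤ seqRearr c₀ k + K := by
  by_cases hK : K = ∞
  · simp [hK]
  rw [← tsub_le_iff_right]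
  refine le_sInf fun s hs => ?_
  rw [tsub_le_iff_right]
  refine sInf_le (lt_of_le_of_lt (encard_le_encard fun n hn => ?_) hs)
  have h1 : s + K < ‖c₀ n + c₁ n‖ₑ := hn
  have h2 : ‖c₀ n + c₁ n‖ₑ ≤ ‖c₀ n‖ₑ + K := (enorm_add_le _ _).trans (by gcongr; exact h n)
  exact lt_of_add_lt_add_right (h1.trans_le h2)

theorem encard_lt_seqRearr_le {ι : Type} (c : ι → ℂ) (s : ℝ≥0∞) :
    {k : ℕ | s < seqRearr c (k + 1)}.encard ≤ {n | s < ‖c n‖ₑ}.encard := by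
  rcases eq_or_ne {n | s < ‖c n‖ₑ}.encard ⊤ with h | h
  · simp [h]
  · lift {n | s < ‖c n‖ₑ}.encard to ℕ using h with N hN
    have : {k : ℕ | s < seqRearr c (k + 1)} ⊆ (Finset.range N : Set ℕ) := fun k hk => by
      have := le_encard_of_lt_seqRearr hk
      rw [← hN] at this
      simp only [Finset.coe_range, mem_Iio]
      exact_mod_cast this
    refine (encard_le_encard this).trans ?_
    rw [encard_coe_eq_coe_finsetCard]
    simp

theorem seqRearr_lt_top {ι : Type} {c : ι → ℂ} {K : ℝ≥0∞} (hK : K ≠ ∞) (h : ∀ n, ‖c n‖ₑ ≤ K)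
    (k : ℕ) : seqRearr c (k + 1) < ∞ := by
  refine lt_of_le_of_lt (sInf_le ?_) hK.lt_top
  have : {n | K < ‖c n‖ₑ} = ∅ := by ext n; simpa using h n
  simp [this]

/-- Layer-cake formula on both sides: the superlevel sets of c^* have no more elements than those of
|c|. Finiteness allows passing to real values. -/
theorem tsum_sq_seqRearr_le {ι : Type} (c : ι → ℂ) (hc : ∑' n, ‖c n‖ₑ ^ 2 ≠ ∞) :
    ∑' k : ℕ, seqRearr c (k + 1) ^ 2 ≤ ∑' n, ‖c n‖ₑ ^ 2 := by
  have hbd : ∀ n, ‖c n‖ₑ ≤ (∑' n, ‖c n‖ₑ ^ 2) ^ (1 / 2 : ℝ) := fun n => by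
    rw [one_div, ENNReal.le_rpow_inv_iff (by norm_num)]
    simpa using ENNReal.le_tsum (f := fun n => ‖c n‖ₑ ^ 2) n
  have hfin : ∀ k : ℕ, seqRearr c (k + 1) ≠ ∞ := fun k =>
    (seqRearr_lt_top (ENNReal.rpow_ne_top_of_nonneg (by norm_num) hc) hbd k).ne
  let _ : MeasurableSpace ι := ⊤
  have hL : ∑' k : ℕ, seqRearr c (k + 1) ^ 2
      = ∫⁻ k, ENNReal.ofReal ((seqRearr c (k + 1)).toReal ^ (2 : ℝ)) ∂(Measure.count : Measure ℕ) := by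
    rw [lintegral_count]
    refine tsum_congr fun k => ?_
    rw [← ENNReal.ofReal_rpow_of_nonneg ENNReal.toReal_nonneg (by norm_num),
      ENNReal.ofReal_toReal (hfin k)]
    simp
  have hR : ∑' n, ‖c n‖ₑ ^ 2
      = ∫⁻ n, ENNReal.ofReal (‖c n‖ ^ (2 : ℝ)) ∂(Measure.count : Measure ι) := by
    rw [lintegral_count]
    refine tsum_congr fun k => ?_
    rw [← ENNReal.ofReal_rpow_of_nonneg (norm_nonneg _) (by norm_num), ofReal_norm]
    simp
  rw [hL, hR, lintegral_rpow_eq_lintegral_meas_lt_mul _ (Filter.Eventually.of_forall fun _ => ENNReal.toReal_nonneg)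
    (Measurable.of_discrete.aemeasurable) (by norm_num), lintegral_rpow_eq_lintegral_meas_lt_mul _ (Filter.Eventually.of_forall fun _ => norm_nonneg _)
    (Measurable.of_discrete.aemeasurable) (by norm_num)]
  gcongr _ * ?_
  refine setLIntegral_mono' measurableSet_Ioi fun t ht => ?_
  gcongr ?_ * _
  rw [Measure.count_apply (MeasurableSet.of_discrete), Measure.count_apply (MeasurableSet.of_discrete)]
  have h1 : {k : ℕ | t < (seqRearr c (k + 1)).toReal} = {k : ℕ | ENNReal.ofReal t < seqRearr c (k + 1)} := by
    ext k
    exact (ENNReal.ofReal_lt_iff_lt_toReal (le_of_lt ht) (hfin k)).symm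
  have h2 : {n | t < ‖c n‖} = {n | ENNReal.ofReal t < ‖c n‖ₑ} := by
    ext n
    simp only [mem_ofPred_eq]
    rw [ENNReal.ofReal_lt_iff_lt_toReal (le_of_lt ht) enorm_ne_top, toReal_enorm]
  rw [h1, h2]
  exact_mod_cast encard_lt_seqRearr_le c _

theorem ennreal_add_sq_le (a b : ℝ≥0∞) : (a + b) ^ 2 ≤ 2 * a ^ 2 + 2 * b ^ 2 := by
  have := ENNReal.rpow_add_le_mul_rpow_add_rpow a b (p := 2) (by norm_num)
  norm_num at this
  rwa [mul_add] at this

theorem sum_sq_seqRearr_add_le {ι : Type} {c₀ c₁ : ι → ℂ} {K : ℝ≥0∞} (h : ∀ n, ‖c₁ n‖ₑ ≤ K)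
    (hc : ∑' n, ‖c₀ n‖ₑ ^ 2 ≠ ∞) (N : ℕ) :
    ∑ k ∈ Finset.range N, seqRearr (fun n => c₀ n + c₁ n) (k + 1) ^ 2
      ≤ 2 * ∑' n, ‖c₀ n‖ₑ ^ 2 + 2 * (N * K ^ 2) := by
  calc _ ≤ ∑ k ∈ Finset.range N, (2 * seqRearr c₀ (k + 1) ^ 2 + 2 * K ^ 2) := by
        refine Finset.sum_le_sum fun k _ => le_trans ?_ (ennreal_add_sq_le _ _)
        gcongr
        exact seqRearr_add_le h _
    _ = 2 * ∑ k ∈ Finset.range N, seqRearr c₀ (k + 1) ^ 2 + 2 * (N * K ^ 2) := by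
        rw [Finset.sum_add_distrib, ← Finset.mul_sum]
        simp
        ring
    _ ≤ _ := by
        gcongr
        exact (ENNReal.sum_le_tsum _).trans (tsum_sq_seqRearr_le c₀ hc)

/-! ### Splitting a function at a level of its rearrangement -/

/-- The normalized dyadic values `2^{-m/2} f^*(2^{-m})` of the rearrangement. -/
noncomputable def dyadicRearr (f : ℝ →ₘ[unitVolume] ℂ) (m : ℕ) : ℝ≥0∞ :=
  (2 : ℝ≥0∞) ^ (-(m : ℝ) / 2) * funRearr f ((1 / 2 : ℝ) ^ m)

theorem two_rpow_ne_top (x : ℝ) : (2 : ℝ≥0∞) ^ x ≠ ∞ :=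
  ENNReal.rpow_ne_top_of_ne_zero two_ne_zero ENNReal.ofNat_ne_top

theorem two_rpow_add (x y : ℝ) : (2 : ℝ≥0∞) ^ (x + y) = 2 ^ x * 2 ^ y :=
  ENNReal.rpow_add _ _ two_ne_zero ENNReal.ofNat_ne_top

theorem ofReal_half_pow (m : ℕ) : ENNReal.ofReal ((1 / 2 : ℝ) ^ m) = (2 : ℝ≥0∞) ^ (-(m : ℝ)) := by
  rw [ENNReal.rpow_neg, ENNReal.rpow_natCast, ENNReal.ofReal_pow (by norm_num), ENNReal.inv_pow]
  congr 1
  rw [one_div, ENNReal.ofReal_inv_of_pos (by norm_num)]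
  simp

theorem measurableSet_lt_enorm (f : ℝ →ₘ[unitVolume] ℂ) (s : ℝ≥0∞) :
    MeasurableSet {x | s < ‖f x‖ₑ} :=
  measurableSet_lt measurable_const f.measurable.enorm

theorem measurableSet_enorm_le (f : ℝ →ₘ[unitVolume] ℂ) (s : ℝ≥0∞) :
    MeasurableSet {x | ‖f x‖ₑ ≤ s} :=
  measurableSet_le f.measurable.enorm measurable_const

theorem setLIntegral_shell_le (f : ℝ →ₘ[unitVolume] ℂ) (m p : ℕ) :
    ∫⁻ x in {x | funRearr f ((1 / 2 : ℝ) ^ m) < ‖f x‖ₑ ∧ ‖f x‖ₑ ≤ funRearr f ((1 / 2 : ℝ) ^ (m + 1))},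
      ‖f x‖ₑ ^ p ∂unitVolume ≤ funRearr f ((1 / 2 : ℝ) ^ (m + 1)) ^ p * 2 ^ (-(m : ℝ)) := by
  refine (setLIntegral_mono' ((measurableSet_lt_enorm f _).inter (measurableSet_enorm_le f _))
    (g := fun _ => funRearr f ((1 / 2 : ℝ) ^ (m + 1)) ^ p) fun x hx => ?_).trans ?_
  · gcongr
    exact hx.2
  · rw [setLIntegral_const, ← ofReal_half_pow]
    gcongr
    exact (measure_mono fun x hx => hx.1).trans (measure_funRearr_lt_le f _)

/-- Induction over shells, starting from the level f^*(1) = 0. The shell between levels m and m+1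
has measure at most 2^{-m} and contributes at most 2 g_{m+1}^2, the 2 coming from the index shift.
-/
theorem setLIntegral_sq_le (f : ℝ →ₘ[unitVolume] ℂ) (J : ℕ) :
    ∫⁻ x in {x | ‖f x‖ₑ ≤ funRearr f ((1 / 2 : ℝ) ^ J)}, ‖f x‖ₑ ^ 2 ∂unitVolume
      ≤ 2 * ∑ m ∈ Finset.range (J + 1), dyadicRearr f m ^ 2 := by
  induction J with
  | zero =>
    refine (setLIntegral_mono' (measurableSet_enorm_le f _) (g := fun _ => 0) fun x hx => ?_).trans
      (by simp)
    have : ‖f x‖ₑ ≤ funRearr f 1 := by simpa using hx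
    rw [funRearr_one] at this
    simpa using this
  | succ J ih =>
    have hsub : {x | ‖f x‖ₑ ≤ funRearr f ((1 / 2 : ℝ) ^ (J + 1))} ⊆
        {x | ‖f x‖ₑ ≤ funRearr f ((1 / 2 : ℝ) ^ J)} ∪
        {x | funRearr f ((1 / 2 : ℝ) ^ J) < ‖f x‖ₑ ∧ ‖f x‖ₑ ≤ funRearr f ((1 / 2 : ℝ) ^ (J + 1))} :=
      fun x hx => (le_or_gt ‖f x‖ₑ (funRearr f ((1 / 2 : ℝ) ^ J))).imp id fun h => ⟨h, hx⟩
    refine (lintegral_mono_set hsub).trans ((lintegral_union_le _ _ _).trans ?_)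
    rw [Finset.sum_range_succ, mul_add]
    gcongr
    refine (setLIntegral_shell_le f J 2).trans (le_of_eq ?_)
    rw [dyadicRearr, mul_pow, ← ENNReal.rpow_natCast (2 ^ _), ← ENNReal.rpow_mul]
    have : (-(J : ℝ)) = 1 + (-((J + 1 : ℕ) : ℝ) / 2 * (2 : ℕ)) := by push_cast; ring
    rw [this, two_rpow_add, ENNReal.rpow_one]
    ring

theorem setLIntegral_tail_le (f : ℝ →ₘ[unitVolume] ℂ) (J : ℕ) :
    ∫⁻ x in {x | funRearr f ((1 / 2 : ℝ) ^ J) < ‖f x‖ₑ}, ‖f x‖ₑ ∂unitVolume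
      ≤ 2 * ∑' m, 2 ^ (-((J + 1 + m : ℕ) : ℝ) / 2) * dyadicRearr f (J + 1 + m) := by
  set F : ℕ → ℝ≥0∞ := fun m => funRearr f ((1 / 2 : ℝ) ^ m) with hF
  -- The shells exhaust the superlevel set except for points above every level, a set of measure at
  -- most 2^{-m} for all m.
  have hnull : unitVolume {x | ∀ m, F m < ‖f x‖ₑ} = 0 := by
    refine le_antisymm (ge_of_tendsto' (x := Filter.atTop) (f := fun m : ℕ => ENNReal.ofReal ((1 / 2 : ℝ) ^ m)) ?_ fun m => ?_) zero_le
    · have := (ENNReal.continuous_ofReal.tendsto 0).comp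
        (tendsto_pow_atTop_nhds_zero_of_lt_one (r := (1 / 2 : ℝ)) (by norm_num) (by norm_num))
      simpa [Function.comp_def] using this
    · exact (measure_mono fun x (hx : ∀ m, F m < ‖f x‖ₑ) => hx m).trans (measure_funRearr_lt_le f _)
  have hsub : {x | F J < ‖f x‖ₑ} ⊆ {x | ∀ m, F m < ‖f x‖ₑ} ∪
      ⋃ m, {x | F (J + m) < ‖f x‖ₑ ∧ ‖f x‖ₑ ≤ F (J + m + 1)} := fun x hx => by
    by_cases hall : ∀ m, F (J + m) < ‖f x‖ₑ
    · refine Or.inl fun m => lt_of_le_of_lt (funRearr_antitone f ?_) (hall m)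
      exact pow_le_pow_of_le_one (by norm_num) (by norm_num) (by omega)
    · push Not at hall
      classical
      right
      rcases hfind : Nat.find hall with _ | n
      · have h1 := Nat.find_spec hall
        rw [hfind] at h1
        exact absurd hx (not_lt.2 h1)
      · have h1 := Nat.find_spec hall
        rw [hfind] at h1
        exact mem_iUnion.2 ⟨n, not_le.1 (Nat.find_min hall (hfind ▸ Nat.lt_succ_self n)), h1⟩
  refine (lintegral_mono_set hsub).trans ((lintegral_union_le _ _ _).trans ?_)
  rw [setLIntegral_measure_zero _ _ hnull, zero_add, ← ENNReal.tsum_mul_left]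
  refine (lintegral_iUnion_le _ _).trans (ENNReal.tsum_le_tsum fun m => ?_)
  have := setLIntegral_shell_le f (J + m) 1
  simp only [pow_one] at this
  refine this.trans (le_of_eq ?_)
  have e : (-((J + m : ℕ) : ℝ)) = 1 + (-((J + 1 + m : ℕ) : ℝ) / 2) + (-((J + 1 + m : ℕ) : ℝ) / 2) := by
    push_cast; ring
  rw [dyadicRearr, e, two_rpow_add, two_rpow_add, ENNReal.rpow_one, show J + 1 + m = J + m + 1 by ring]
  ring

/-! ### Fourier coefficients -/

theorem tsum_sq_inner_le {ι : Type} {φ : ι → Lp ℂ 2 unitVolume} (hφ : Orthonormal ℂ φ)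
    (g : Lp ℂ 2 unitVolume) : ∑' n, ‖inner ℂ (φ n) g‖ₑ ^ 2 ≤ ‖g‖ₑ ^ 2 := by
  rw [ENNReal.tsum_eq_iSup_sum]
  refine iSup_le fun s => ?_
  have := ENNReal.ofReal_le_ofReal (hφ.sum_inner_products_le g (s := s))
  rw [ENNReal.ofReal_sum_of_nonneg (fun _ _ => by positivity)] at this
  simpa [ENNReal.ofReal_pow, ofReal_norm] using this

theorem integrable_of_split {f : ℝ →ₘ[unitVolume] ℂ} {s : ℝ≥0∞}
    (h₀ : ∫⁻ x in {x | ‖f x‖ₑ ≤ s}, ‖f x‖ₑ ^ 2 ∂unitVolume ≠ ∞)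
    (h₁ : ∫⁻ x in {x | s < ‖f x‖ₑ}, ‖f x‖ₑ ∂unitVolume ≠ ∞) :
    MemLp ({x | ‖f x‖ₑ ≤ s}.indicator f) 2 unitVolume ∧
      Integrable ({x | s < ‖f x‖ₑ}.indicator f) unitVolume := by
  refine ⟨⟨(f.aestronglyMeasurable.indicator (measurableSet_enorm_le f s)), ?_⟩,
    ⟨(f.aestronglyMeasurable.indicator (measurableSet_lt_enorm f s)), ?_⟩⟩
  · rw [eLpNorm_indicator_eq_eLpNorm_restrict (measurableSet_enorm_le f s),
      eLpNorm_eq_lintegral_rpow_enorm_toReal (by simp) (by simp)]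
    refine (ENNReal.rpow_ne_top_of_nonneg (by simp) ?_).lt_top
    simpa using h₀
  · rw [HasFiniteIntegral]
    simp_rw [enorm_indicator_eq_indicator_enorm]
    rw [lintegral_indicator (measurableSet_lt_enorm f s)]
    exact h₁.lt_top

theorem indicator_split (f : ℝ →ₘ[unitVolume] ℂ) (s : ℝ≥0∞) (x : ℝ) :
    f x = {x | ‖f x‖ₑ ≤ s}.indicator f x + {x | s < ‖f x‖ₑ}.indicator f x := by
  by_cases h : ‖f x‖ₑ ≤ s
  · simp [indicator, h]
  · simp [indicator, h, not_le.1 h]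

/-- Bessel handles the part of f below s. The part above s perturbs every coefficient by at most M
times its L_1 norm, hence every value of the rearrangement by no more. -/
theorem sum_sq_fourierMap_le {ι : Type} {φ : ι → Lp ℂ 2 unitVolume} (hφ : Orthonormal ℂ φ)
    {M : ℝ≥0} (hM : ∀ n, eLpNorm (φ n) ∞ unitVolume ≤ M) {f : ℝ →ₘ[unitVolume] ℂ} {s : ℝ≥0∞}
    (h₀ : ∫⁻ x in {x | ‖f x‖ₑ ≤ s}, ‖f x‖ₑ ^ 2 ∂unitVolume ≠ ∞)
    (h₁ : ∫⁻ x in {x | s < ‖f x‖ₑ}, ‖f x‖ₑ ∂unitVolume ≠ ∞) (N : ℕ) :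
    ∑ k ∈ Finset.range N, seqRearr (fourierMap φ f) (k + 1) ^ 2 ≤
      2 * ∫⁻ x in {x | ‖f x‖ₑ ≤ s}, ‖f x‖ₑ ^ 2 ∂unitVolume +
      2 * (N * (M * ∫⁻ x in {x | s < ‖f x‖ₑ}, ‖f x‖ₑ ∂unitVolume) ^ 2) := by
  obtain ⟨hf₀, hf₁⟩ := integrable_of_split h₀ h₁
  set f₀ := {x | ‖f x‖ₑ ≤ s}.indicator f with hf₀def
  set f₁ := {x | s < ‖f x‖ₑ}.indicator f with hf₁def
  have hφM : ∀ n, ∀ᵐ x ∂unitVolume, ‖φ n x‖ₑ ≤ M := fun n => by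
    filter_upwards [ae_le_eLpNormEssSup (f := φ n) (μ := unitVolume)] with x hx
    exact hx.trans (by simpa using hM n)
  have hstar : ∀ n, ∀ᵐ x ∂unitVolume, ‖(starRingEnd ℂ) (φ n x)‖ ≤ M := fun n => by
    filter_upwards [hφM n] with x hx
    rw [RCLike.norm_conj]
    exact_mod_cast enorm_le_coe.1 hx
  have hmeas : ∀ n, AEStronglyMeasurable (fun x => (starRingEnd ℂ) (φ n x)) unitVolume := fun n =>
    Complex.continuous_conj.comp_aestronglyMeasurable (Lp.aestronglyMeasurable (φ n))
  have hdec : fourierMap φ f = fun n => inner ℂ (φ n) (hf₀.toLp f₀) +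
      ∫ x, f₁ x * (starRingEnd ℂ) (φ n x) ∂unitVolume := by
    funext n
    have e₀ : inner ℂ (φ n) (hf₀.toLp f₀) = ∫ x, f₀ x * (starRingEnd ℂ) (φ n x) ∂unitVolume := by
      rw [L2.inner_def]
      refine integral_congr_ae ?_
      filter_upwards [hf₀.coeFn_toLp] with x hx
      rw [hx, RCLike.inner_apply]
    rw [e₀, fourierMap, ← integral_add]
    · congr 1 with x
      rw [← add_mul, ← indicator_split]
    · exact (hf₀.integrable (by norm_num)).mul_bdd (hmeas n) (hstar n)
    · exact hf₁.mul_bdd (hmeas n) (hstar n)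
  have hc₁ : ∀ n, ‖∫ x, f₁ x * (starRingEnd ℂ) (φ n x) ∂unitVolume‖ₑ
      ≤ M * ∫⁻ x in {x | s < ‖f x‖ₑ}, ‖f x‖ₑ ∂unitVolume := fun n => by
    refine (enorm_integral_le_lintegral_enorm _).trans ?_
    rw [← lintegral_indicator (measurableSet_lt_enorm f s), ← lintegral_const_mul' _ _ ENNReal.coe_ne_top]
    refine lintegral_mono_ae ?_
    filter_upwards [hφM n] with x hx
    rw [enorm_mul, mul_comm, hf₁def, enorm_indicator_eq_indicator_enorm]
    gcongr
    simpa [enorm_eq_nnnorm] using hx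
  have hnorm : ‖hf₀.toLp f₀‖ₑ ^ 2 = ∫⁻ x in {x | ‖f x‖ₑ ≤ s}, ‖f x‖ₑ ^ 2 ∂unitVolume := by
    rw [Lp.enorm_toLp, hf₀def, eLpNorm_indicator_eq_eLpNorm_restrict (measurableSet_enorm_le f s),
      eLpNorm_eq_lintegral_rpow_enorm_toReal (by simp) (by simp), ← ENNReal.rpow_natCast,
      ← ENNReal.rpow_mul]
    simp
  have hB := tsum_sq_inner_le hφ (hf₀.toLp f₀)
  rw [hnorm] at hB
  rw [hdec]
  refine (sum_sq_seqRearr_add_le hc₁ (ne_top_of_le_ne_top h₀ hB) N).trans ?_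
  gcongr

/-! ### Dyadic discretization of the function quasi-norm -/

theorem rpow_le_of_comparable {x y K : ℝ} (hx : 0 < x) (hy : 0 < y) (hK : 0 < K)
    (hxy : x ≤ K * y) (hyx : y ≤ K * x) (e : ℝ) : x ^ e ≤ K ^ |e| * y ^ e := by
  rcases le_or_gt 0 e with he | he
  · rw [abs_of_nonneg he, ← Real.mul_rpow hK.le hy.le]
    exact Real.rpow_le_rpow hx.le hxy he
  · rw [abs_of_neg he, Real.rpow_neg hK.le, ← Real.inv_rpow hK.le,
      ← Real.mul_rpow (by positivity) hy.le]
    refine Real.rpow_le_rpow_of_nonpos (by positivity) ?_ he.le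
    rwa [inv_mul_le_iff₀ hK]

theorem recip_two : recip 2 = 1 / 2 := by simp [recip]

theorem two_rpow_eq_ofReal (x : ℝ) : (2 : ℝ≥0∞) ^ x = ENNReal.ofReal ((2 : ℝ) ^ x) := by
  rw [← ENNReal.ofReal_rpow_of_pos (by norm_num)]
  simp

/-- On the shell, t and 2^{-m}, as well as 1 + |log t| and m + 1, agree up to a factor 2. With e =
1/q, the factor 2^{-me} matches the measure of the shell in L_q. -/
theorem weight_le {γ e t : ℝ} {m : ℕ} (h₁ : (1 / 2 : ℝ) ^ (m + 1) < t) (h₂ : t < (1 / 2 : ℝ) ^ m) :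
    ((m : ℝ) + 1) ^ γ * (2 : ℝ) ^ (-(m : ℝ) / 2) ≤
      2 ^ (|γ| + |1 / 2 - e|) * (2 : ℝ) ^ (-(m : ℝ) * e) *
        (t ^ (1 / 2 - e) * (1 + |Real.log t|) ^ γ) := by
  have ht : 0 < t := lt_trans (by positivity) h₁
  have hl2 := Real.log_two_gt_d9
  have hl2' := Real.log_two_lt_d9
  have hm0 : (0 : ℝ) ≤ m := by positivity
  have l₁ : -(((m : ℝ) + 1) * Real.log 2) < Real.log t := by
    have := Real.log_lt_log (by positivity) h₁
    rw [Real.log_pow, one_div, Real.log_inv] at this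
    push_cast at this
    linarith
  have l₂ : Real.log t < -((m : ℝ) * Real.log 2) := by
    have := Real.log_lt_log ht h₂
    rw [Real.log_pow, one_div, Real.log_inv] at this
    linarith
  have habs : |Real.log t| = -Real.log t := abs_of_neg (by nlinarith)
  have a₁ : ((m : ℝ) + 1) ^ γ ≤ 2 ^ |γ| * (1 + |Real.log t|) ^ γ :=
    rpow_le_of_comparable (by positivity) (by positivity) two_pos (by rw [habs]; nlinarith)
      (by rw [habs]; nlinarith) γ
  have a₂ : ((1 / 2 : ℝ) ^ m) ^ (1 / 2 - e) ≤ 2 ^ |1 / 2 - e| * t ^ (1 / 2 - e) :=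
    rpow_le_of_comparable (by positivity) ht two_pos (by rw [pow_succ] at h₁; linarith)
      (by linarith [show (0:ℝ) < (1 / 2 : ℝ) ^ m by positivity]) _
  have a₃ : (2 : ℝ) ^ (-(m : ℝ) / 2) = (2 : ℝ) ^ (-(m : ℝ) * e) * ((1 / 2 : ℝ) ^ m) ^ (1 / 2 - e) := by
    have : (1 / 2 : ℝ) ^ m = 2 ^ (-(m : ℝ)) := by
      rw [Real.rpow_neg two_pos.le, Real.rpow_natCast]; simp
    rw [this, ← Real.rpow_mul two_pos.le, ← Real.rpow_add two_pos]
    ring_nf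
  rw [a₃, Real.rpow_add two_pos]
  calc _ ≤ (2 ^ |γ| * (1 + |Real.log t|) ^ γ) * ((2 : ℝ) ^ (-(m : ℝ) * e) * (2 ^ |1 / 2 - e| * t ^ (1 / 2 - e))) := by
        gcongr
    _ = _ := by ring

/-- The interior of the `m`-th dyadic shell of `(0, 1)`. -/
def dyadicShell (m : ℕ) : Set ℝ := Ioo ((1 / 2 : ℝ) ^ (m + 1)) ((1 / 2 : ℝ) ^ m)

theorem dyadicShell_subset (m : ℕ) : dyadicShell m ⊆ Ioo 0 1 := fun _ ht =>
  ⟨lt_trans (by positivity) ht.1, ht.2.trans_le (pow_le_one₀ (by norm_num) (by norm_num))⟩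

theorem dyadicShell_disjoint : Pairwise (Function.onFun Disjoint dyadicShell) := by
  have key : ∀ m n : ℕ, m < n → Disjoint (dyadicShell m) (dyadicShell n) := fun m n h => by
    refine Set.disjoint_left.2 fun t h₁ h₂ => ?_
    have : (1 / 2 : ℝ) ^ n ≤ (1 / 2 : ℝ) ^ (m + 1) :=
      pow_le_pow_of_le_one (by norm_num) (by norm_num) h
    exact absurd (h₁.1.trans h₂.2) (not_lt.2 this)
  intro m n h
  rcases lt_or_gt_of_ne h with h | h
  · exact key m n h
  · exact (key n m h).symm

theorem volume_dyadicShell (m : ℕ) : volume (dyadicShell m) = 2 ^ (-(m : ℝ) - 1) := by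
  rw [dyadicShell, Real.volume_Ioo, pow_succ, sub_eq_add_neg (-(m : ℝ)), two_rpow_add, ← ofReal_half_pow]
  rw [show (1 / 2 : ℝ) ^ m - (1 / 2) ^ m * (1 / 2) = (1 / 2) ^ m * (1 / 2) by ring,
    ENNReal.ofReal_mul (by positivity)]
  congr 1
  rw [ENNReal.rpow_neg_one, one_div, ENNReal.ofReal_inv_of_pos (by norm_num)]
  simp

/-- The Lorentz–Zygmund quasi-norm dominates its dyadic discretization. -/
theorem lqNorm_dyadicRearr_le {q : ℝ≥0∞} (h0 : q ≠ 0) (γ : ℝ) :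
    ∃ C : ℝ≥0∞, C ≠ ∞ ∧ ∀ f : ℝ →ₘ[unitVolume] ℂ,
      lqNorm q (fun m => ENNReal.ofReal (((m : ℝ) + 1) ^ γ) * dyadicRearr f m)
        ≤ C * lzFunNorm 2 q γ f := by
  set e := recip q with he
  set C₁ : ℝ≥0∞ := ENNReal.ofReal (2 ^ (|γ| + |1 / 2 - e|)) with hC₁
  have key : ∀ (f : ℝ →ₘ[unitVolume] ℂ) (m : ℕ), ∀ t ∈ dyadicShell m,
      ENNReal.ofReal (((m : ℝ) + 1) ^ γ) * dyadicRearr f m ≤ C₁ * 2 ^ (-(m : ℝ) * e) *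
        (ENNReal.ofReal (t ^ (recip 2 - recip q) * (1 + |Real.log t|) ^ γ) * funRearr f t) := by
    intro f m t ht
    rw [dyadicRearr, ← mul_assoc, ← mul_assoc, hC₁, two_rpow_eq_ofReal, two_rpow_eq_ofReal,
      ← ENNReal.ofReal_mul (by positivity), ← ENNReal.ofReal_mul (by positivity),
      ← ENNReal.ofReal_mul (by positivity), recip_two, ← he]
    gcongr ?_ * ?_
    · exact ENNReal.ofReal_le_ofReal (weight_le ht.1 ht.2)
    · exact funRearr_antitone f ht.2.le
  by_cases hqt : q = ∞
  · subst hqt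
    refine ⟨C₁, by simp [hC₁], fun f => ?_⟩
    rw [lqNorm_top]
    refine iSup_le fun m => ?_
    have hae := ae_le_eLpNormEssSup (μ := volume.restrict (Ioo (0 : ℝ) 1))
      (f := fun t : ℝ => ENNReal.ofReal (t ^ (recip 2 - recip ∞) * (1 + |Real.log t|) ^ γ)
        * funRearr f t)
    have hae' := ae_restrict_of_ae_restrict_of_subset (dyadicShell_subset m) hae
    -- The shell has positive measure, so the essential supremum bound holds at some point of it.
    have hne : volume.restrict (dyadicShell m) ≠ 0 := by
      rw [Ne, Measure.restrict_eq_zero, volume_dyadicShell]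
      exact (ENNReal.rpow_pos (by norm_num) (by norm_num)).ne'
    have : (ae (volume.restrict (dyadicShell m))).NeBot := ae_neBot.2 hne
    obtain ⟨t, ht, htm⟩ := (hae'.and (ae_restrict_mem measurableSet_Ioo)).exists
    refine (key f m t htm).trans ?_
    have he0 : e = 0 := by simp [he, recip]
    rw [he0, mul_zero, ENNReal.rpow_zero, mul_one, lzFunNorm, eLpNorm_exponent_top]
    gcongr
    simpa using ht
  · have hp := ENNReal.toReal_pos h0 hqt
    have hep : e * q.toReal = 1 := by
      rw [he, recip, ENNReal.toReal_inv, inv_mul_cancel₀ hp.ne']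
    set p := q.toReal
    refine ⟨C₁ * 2 ^ (1 / p), ENNReal.mul_ne_top (by simp [hC₁]) (two_rpow_ne_top _),
      fun f => le_of_rpow_le hp ?_⟩
    set h : ℝ → ℝ≥0∞ := fun t => ENNReal.ofReal (t ^ (recip 2 - recip q) * (1 + |Real.log t|) ^ γ)
        * funRearr f t with hh
    have hnorm : lzFunNorm 2 q γ f ^ p = ∫⁻ t in Ioo (0 : ℝ) 1, h t ^ p := by
      rw [lzFunNorm, eLpNorm_eq_lintegral_rpow_enorm_toReal h0 hqt, ← ENNReal.rpow_mul,
        one_div_mul_cancel hp.ne', ENNReal.rpow_one]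
      simp [hh, p]
    rw [ENNReal.mul_rpow_of_nonneg _ _ hp.le, ENNReal.mul_rpow_of_nonneg _ _ hp.le,
      ← ENNReal.rpow_mul, one_div_mul_cancel hp.ne', ENNReal.rpow_one, lqNorm_rpow h0 hqt, hnorm]
    calc ∑' m : ℕ, (ENNReal.ofReal (((m : ℝ) + 1) ^ γ) * dyadicRearr f m) ^ p
        ≤ ∑' m : ℕ, C₁ ^ p * 2 * ∫⁻ t in dyadicShell m, h t ^ p := by
          refine ENNReal.tsum_le_tsum fun m => ?_
          have hI : (ENNReal.ofReal (((m : ℝ) + 1) ^ γ) * dyadicRearr f m) ^ p * 2 ^ (-(m : ℝ) - 1)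
              ≤ C₁ ^ p * 2 ^ (-(m : ℝ)) * ∫⁻ t in dyadicShell m, h t ^ p := by
            rw [← volume_dyadicShell, ← setLIntegral_const, ← lintegral_const_mul' _ _
              (ENNReal.mul_ne_top (ENNReal.rpow_ne_top_of_nonneg hp.le (by simp [hC₁])) (two_rpow_ne_top _))]
            refine setLIntegral_mono' measurableSet_Ioo fun t ht => ?_
            refine (ENNReal.rpow_le_rpow (key f m t ht) hp.le).trans (le_of_eq ?_)
            rw [ENNReal.mul_rpow_of_nonneg _ _ hp.le, ENNReal.mul_rpow_of_nonneg _ _ hp.le,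
              ← ENNReal.rpow_mul, mul_assoc (-(m : ℝ)), hep, mul_one]
          have e₁ : (2 : ℝ≥0∞) ^ (-(m : ℝ) - 1) * 2 ^ ((m : ℝ) + 1) = 1 := by
            rw [← two_rpow_add]; simp
          have e₂ : (2 : ℝ≥0∞) ^ (-(m : ℝ)) * 2 ^ ((m : ℝ) + 1) = 2 := by
            rw [← two_rpow_add]; simp
          calc _ = (ENNReal.ofReal (((m : ℝ) + 1) ^ γ) * dyadicRearr f m) ^ p *
                (2 ^ (-(m : ℝ) - 1) * 2 ^ ((m : ℝ) + 1)) := by rw [e₁, mul_one]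
            _ ≤ C₁ ^ p * 2 ^ (-(m : ℝ)) * (∫⁻ t in dyadicShell m, h t ^ p) * 2 ^ ((m : ℝ) + 1) := by
                rw [← mul_assoc]
                gcongr
            _ = C₁ ^ p * (2 ^ (-(m : ℝ)) * 2 ^ ((m : ℝ) + 1)) * ∫⁻ t in dyadicShell m, h t ^ p := by
                ring
            _ = _ := by rw [e₂]
      _ = C₁ ^ p * 2 * ∫⁻ t in ⋃ m, dyadicShell m, h t ^ p := by
          rw [ENNReal.tsum_mul_left, lintegral_iUnion (s := dyadicShell) (fun _ => measurableSet_Ioo)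
            dyadicShell_disjoint]
      _ ≤ _ := by
          gcongr
          exact iUnion_subset dyadicShell_subset

/-! ### Weighted inequalities for sequences -/

theorem ofReal_rpow_mul_inv {x : ℝ} (hx : 0 < x) (γ : ℝ) :
    ENNReal.ofReal (x ^ (-γ)) * ENNReal.ofReal (x ^ γ) = 1 := by
  rw [← ENNReal.ofReal_mul (by positivity), ← Real.rpow_add hx]
  simp

theorem tsum_weight_ne_top (γ : ℝ) :
    ∑' m : ℕ, (2 : ℝ≥0∞) ^ (-(m : ℝ) / 4) * ENNReal.ofReal (((m : ℝ) + 1) ^ γ) ≠ ∞ := by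
  obtain ⟨k, hk⟩ := exists_nat_ge γ
  obtain ⟨r, hr⟩ : ∃ r : ℝ, r = 2 ^ (-(1 / 4) : ℝ) := ⟨_, rfl⟩
  have hr0 : 0 < r := by rw [hr]; positivity
  have hr1 : r < 1 := by
    rw [hr]
    exact Real.rpow_lt_one_of_one_lt_of_neg (by norm_num) (by norm_num)
  have hs : Summable fun m : ℕ => r⁻¹ * (((m + 1 : ℕ) : ℝ) ^ k * r ^ (m + 1)) :=
    ((summable_nat_add_iff (f := fun m : ℕ => (m : ℝ) ^ k * r ^ m) 1).2
      (summable_pow_mul_geometric_of_norm_lt_one k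
        (by rwa [Real.norm_of_nonneg hr0.le]))).mul_left r⁻¹
  refine ne_top_of_le_ne_top hs.tsum_ofReal_ne_top (ENNReal.tsum_le_tsum fun m => ?_)
  rw [two_rpow_eq_ofReal, ← ENNReal.ofReal_mul (by positivity)]
  refine ENNReal.ofReal_le_ofReal ?_
  have e₁ : (2 : ℝ) ^ (-(m : ℝ) / 4) = r ^ m := by
    rw [hr, ← Real.rpow_natCast, ← Real.rpow_mul two_pos.le]
    ring_nf
  have e₂ : ((m : ℝ) + 1) ^ γ ≤ ((m + 1 : ℕ) : ℝ) ^ k := by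
    rw [← Real.rpow_natCast]
    push_cast
    exact Real.rpow_le_rpow_of_exponent_le (by simp) hk
  have e₃ : r⁻¹ * (((m + 1 : ℕ) : ℝ) ^ k * r ^ (m + 1)) = r ^ m * ((m + 1 : ℕ) : ℝ) ^ k := by
    rw [pow_succ]
    field_simp
  rw [e₁, e₃]
  gcongr

/-- Every weighted term is at most the ℓ^q norm, and geometric decay beats any inverse power weight.
-/
theorem tsum_decay_le {q : ℝ≥0∞} (h0 : q ≠ 0) (γ : ℝ) :
    ∃ C : ℝ≥0∞, C ≠ ∞ ∧ ∀ g : ℕ → ℝ≥0∞, ∑' m : ℕ, 2 ^ (-(m : ℝ) / 4) * g m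
      ≤ C * lqNorm q (fun m => ENNReal.ofReal (((m : ℝ) + 1) ^ γ) * g m) := by
  refine ⟨_, tsum_weight_ne_top (-γ), fun g => ?_⟩
  rw [← ENNReal.tsum_mul_right]
  refine ENNReal.tsum_le_tsum fun m => ?_
  rw [mul_assoc]
  gcongr
  calc g m = ENNReal.ofReal (((m : ℝ) + 1) ^ (-γ)) * (ENNReal.ofReal (((m : ℝ) + 1) ^ γ) * g m) := by
        rw [← mul_assoc, ofReal_rpow_mul_inv (by positivity), one_mul]
    _ ≤ _ := by
        gcongr
        exact le_lqNorm h0 (fun m : ℕ => ENNReal.ofReal (((m : ℝ) + 1) ^ γ) * g m) m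

/-- The endpoints start at 0, as block summation requires, and give 2^r ≤ m + 1 < 2^{r+1} on block
r. -/
theorem strictMono_two_pow_sub_one : StrictMono fun r : ℕ => 2 ^ r - 1 :=
  strictMono_nat_of_lt_succ fun r => by
    have := Nat.one_le_two_pow (n := r)
    simp only [pow_succ]
    omega

theorem block_weight_le (γ : ℝ) {r m : ℕ} (hm : m ∈ Finset.Ico (2 ^ r - 1) (2 ^ (r + 1) - 1)) :
    (2 : ℝ≥0∞) ^ (r * γ) ≤ 2 ^ |γ| * ENNReal.ofReal (((m : ℝ) + 1) ^ γ) := by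
  obtain ⟨h₁, h₂⟩ := Finset.mem_Ico.1 hm
  have h₁' : (2 : ℝ) ^ r ≤ m + 1 := by exact_mod_cast (show 2 ^ r ≤ m + 1 by omega)
  have h₂' : (m : ℝ) + 1 ≤ 2 * 2 ^ r := by
    exact_mod_cast (show m + 1 ≤ 2 * 2 ^ r by rw [pow_succ] at h₂; omega)
  rw [two_rpow_eq_ofReal, two_rpow_eq_ofReal, ← ENNReal.ofReal_mul (by positivity),
    Real.rpow_mul two_pos.le, Real.rpow_natCast]
  refine ENNReal.ofReal_le_ofReal (rpow_le_of_comparable (by positivity) (by positivity) two_pos ?_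
    h₂' γ)
  linarith

/-- The `ℓ²` norm over the dyadic blocks is controlled by the weighted `ℓ^q` norm. -/
theorem lqNorm_block_sqrt_le {q : ℝ≥0∞} (h0 : q ≠ 0) (α : ℝ) :
    ∃ C : ℝ≥0∞, C ≠ ∞ ∧ ∀ g : ℕ → ℝ≥0∞,
      lqNorm q (fun r => 2 ^ (r * (α + recip q)) *
        (∑ m ∈ Finset.Ico (2 ^ r - 1) (2 ^ (r + 1) - 1), g m ^ (2 : ℝ)) ^ (1 / 2 : ℝ))
      ≤ C * lqNorm q (fun m => ENNReal.ofReal (((m : ℝ) + 1) ^ (α + recip (min q 2))) * g m) := by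
  set γ := α + recip (min q 2) with hγ
  refine ⟨2 ^ |γ|, two_rpow_ne_top _, fun g => ?_⟩
  have hcard : ∀ r : ℕ, ((Finset.Ico (2 ^ r - 1) (2 ^ (r + 1) - 1)).card : ℝ≥0∞) = 2 ^ (r : ℝ) := by
    intro r
    rw [Nat.card_Ico, ENNReal.rpow_natCast, show 2 ^ (r + 1) - 1 - (2 ^ r - 1) = 2 ^ r by
      have := Nat.one_le_two_pow (n := r)
      rw [pow_succ]; omega]
    simp
  by_cases hqt : q = ∞
  · subst hqt
    have hγ' : γ = α + 1 / 2 := by simp [hγ, recip]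
    have hr0 : recip ∞ = 0 := by simp [recip]
    rw [lqNorm_top, hr0]
    refine iSup_le fun r => ?_
    set S := lqNorm ∞ (fun m : ℕ => ENNReal.ofReal (((m : ℝ) + 1) ^ γ) * g m) with hS
    have hg : ∀ m ∈ Finset.Ico (2 ^ r - 1) (2 ^ (r + 1) - 1), 2 ^ (r * γ) * g m ≤ 2 ^ |γ| * S := by
      intro m hm
      calc 2 ^ (r * γ) * g m ≤ 2 ^ |γ| * ENNReal.ofReal (((m : ℝ) + 1) ^ γ) * g m := by
            gcongr; exact block_weight_le γ hm
        _ ≤ _ := by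
            rw [mul_assoc]
            gcongr
            exact le_lqNorm (by simp) (fun m : ℕ => ENNReal.ofReal (((m : ℝ) + 1) ^ γ) * g m) m
    refine le_of_rpow_le (p := 2) two_pos ?_
    rw [ENNReal.mul_rpow_of_nonneg _ _ two_pos.le, ← ENNReal.rpow_mul, ← ENNReal.rpow_mul,
      one_div_mul_cancel two_ne_zero, ENNReal.rpow_one]
    have e₁ : (r : ℝ) * (α + 0) * 2 = -(r : ℝ) + r * γ * 2 := by rw [hγ']; ring
    calc (2 : ℝ≥0∞) ^ ((r : ℝ) * (α + 0) * 2) *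
          ∑ m ∈ Finset.Ico (2 ^ r - 1) (2 ^ (r + 1) - 1), g m ^ (2 : ℝ)
        = 2 ^ (-(r : ℝ)) * ∑ m ∈ Finset.Ico (2 ^ r - 1) (2 ^ (r + 1) - 1),
            (2 ^ (r * γ) * g m) ^ (2 : ℝ) := by
          rw [e₁, two_rpow_add, mul_assoc, Finset.mul_sum]
          congr 1
          refine Finset.sum_congr rfl fun m _ => ?_
          rw [ENNReal.mul_rpow_of_nonneg _ _ two_pos.le, ← ENNReal.rpow_mul]
      _ ≤ 2 ^ (-(r : ℝ)) * ∑ m ∈ Finset.Ico (2 ^ r - 1) (2 ^ (r + 1) - 1),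
            (2 ^ |γ| * S) ^ (2 : ℝ) := by
          exact mul_le_mul_right (Finset.sum_le_sum fun m hm =>
            ENNReal.rpow_le_rpow (hg m hm) two_pos.le) _
      _ = _ := by
          rw [Finset.sum_const, nsmul_eq_mul, hcard, ← mul_assoc, ← two_rpow_add]
          simp
  · have hp := ENNReal.toReal_pos h0 hqt
    have hep : recip q * q.toReal = 1 := by
      rw [recip, ENNReal.toReal_inv, inv_mul_cancel₀ hp.ne']
    refine le_of_rpow_le hp ?_
    rw [ENNReal.mul_rpow_of_nonneg _ _ hp.le, lqNorm_rpow h0 hqt, lqNorm_rpow h0 hqt,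
      ← tsum_blocks _ strictMono_two_pow_sub_one rfl
        (fun m : ℕ => (ENNReal.ofReal (((m : ℝ) + 1) ^ γ) * g m) ^ q.toReal),
      ← ENNReal.tsum_mul_left]
    have hle2 : q.toReal ≤ 2 ↔ q ≤ 2 := by
      conv_lhs => rw [← ENNReal.toReal_ofNat 2]
      rw [ENNReal.toReal_le_toReal hqt (by simp)]
    set p := q.toReal
    refine ENNReal.tsum_le_tsum fun r => ?_
    -- For q ≤ 2, ℓ^q embeds in ℓ^2 without loss. For q ≥ 2, Hölder on the 2^r terms costs
    -- 2^{r(q/2-1)}, which turns 1/q into 1/2. This is the source of 1/min(q,2).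
    have hstep : (2 : ℝ≥0∞) ^ (r * (α + recip q) * p) *
        (∑ m ∈ Finset.Ico (2 ^ r - 1) (2 ^ (r + 1) - 1), g m ^ (2 : ℝ)) ^ (1 / 2 * p)
        ≤ ∑ m ∈ Finset.Ico (2 ^ r - 1) (2 ^ (r + 1) - 1), (2 ^ (r * γ) * g m) ^ p := by
      have hpow : ∀ m, (g m ^ (2 : ℝ)) ^ (1 / 2 * p) = g m ^ p := fun m => by
        rw [← ENNReal.rpow_mul]
        congr 1
        ring
      simp_rw [ENNReal.mul_rpow_of_nonneg _ _ hp.le, ← ENNReal.rpow_mul]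
      rw [← Finset.mul_sum]
      rcases le_total q 2 with h2 | h2
      · rw [hγ, min_eq_left h2]
        gcongr
        refine (rpow_sum_le_sum_rpow _ _ (by positivity) ?_).trans (le_of_eq ?_)
        · linarith [hle2.2 h2]
        · simp_rw [hpow]
      · have h2p : 2 ≤ p := by
          rcases le_total p 2 with h | h
          · have := le_antisymm h2 (hle2.1 h)
            simp only [p, ← this]
            simp
          · exact h
        have e₁ : (r : ℝ) * γ * p = r * (α + recip q) * p + r * (1 / 2 * p - 1) := by
          rw [hγ, min_eq_right h2, recip_two]
          linear_combination (-(r : ℝ)) * hep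
        rw [e₁, two_rpow_add, mul_assoc ((2 : ℝ≥0∞) ^ _)]
        refine mul_le_mul_right ?_ _
        refine (ENNReal.rpow_sum_le_const_mul_sum_rpow _ _
          (show 1 ≤ 1 / 2 * p by linarith)).trans (le_of_eq ?_)
        rw [hcard, ← ENNReal.rpow_mul]
        simp_rw [hpow]
    rw [ENNReal.mul_rpow_of_nonneg _ _ hp.le, ← ENNReal.rpow_mul, ← ENNReal.rpow_mul]
    refine hstep.trans ?_
    rw [Finset.mul_sum]
    refine Finset.sum_le_sum fun m hm => ?_
    rw [← ENNReal.mul_rpow_of_nonneg _ _ hp.le, ← mul_assoc]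
    gcongr
    exact block_weight_le γ hm

theorem two_rpow_lt_one {β : ℝ} (h : β < 0) : (2 : ℝ≥0∞) ^ β < 1 := by
  rw [two_rpow_eq_ofReal, ENNReal.ofReal_lt_one]
  exact Real.rpow_lt_one_of_one_lt_of_neg (by norm_num) h

theorem lqNorm_geometric_ne_top {q : ℝ≥0∞} (h0 : q ≠ 0) {β : ℝ} (h : β < 0) :
    lqNorm q (fun i => (2 : ℝ≥0∞) ^ (i * β)) ≠ ∞ := by
  have hpow : ∀ i : ℕ, (2 : ℝ≥0∞) ^ (i * β) = (2 ^ β) ^ i := fun i => by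
    rw [← ENNReal.rpow_natCast, ← ENNReal.rpow_mul, mul_comm]
  by_cases hqt : q = ∞
  · subst hqt
    rw [lqNorm_top]
    refine ne_top_of_le_ne_top ENNReal.one_ne_top (iSup_le fun i => ?_)
    rw [hpow]
    exact pow_le_one₀ zero_le (two_rpow_lt_one h).le
  · have hp := ENNReal.toReal_pos h0 hqt
    rw [lqNorm_eq_tsum h0 hqt]
    refine ENNReal.rpow_ne_top_of_nonneg (by positivity) ?_
    have : ∀ i : ℕ, ((2 : ℝ≥0∞) ^ (i * β)) ^ q.toReal = (2 ^ (β * q.toReal)) ^ i := fun i => by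
      rw [← ENNReal.rpow_natCast, ← ENNReal.rpow_mul, ← ENNReal.rpow_mul]
      ring_nf
    simp_rw [this]
    exact tsum_geometric_ne_top (two_rpow_lt_one (mul_neg_of_neg_of_pos h hp))

/-- A limiting Hardy inequality for the partial `ℓ²` sums at doubly exponential scale. -/
theorem lqNorm_partial_sqrt_le {q : ℝ≥0∞} (h0 : q ≠ 0) {α : ℝ} (hα : α + recip q < 0) :
    ∃ C : ℝ≥0∞, C ≠ ∞ ∧ ∀ g : ℕ → ℝ≥0∞,
      lqNorm q (fun i => 2 ^ (i * (α + recip q)) *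
        (∑ m ∈ Finset.range (2 ^ i - 1), g m ^ (2 : ℝ)) ^ (1 / 2 : ℝ))
      ≤ C * lqNorm q (fun m => ENNReal.ofReal (((m : ℝ) + 1) ^ (α + recip (min q 2))) * g m) := by
  obtain ⟨C₁, hC₁, h₁⟩ := lqNorm_block_sqrt_le h0 α
  obtain ⟨C₂, hC₂, h₂⟩ := lqNorm_geometric_conv_le h0 (two_rpow_lt_one hα)
  refine ⟨C₂ * C₁, ENNReal.mul_ne_top hC₂ hC₁, fun g => ?_⟩
  rw [mul_assoc]
  refine le_trans (le_trans (lqNorm_mono fun i => ?_) (h₂ _)) (mul_le_mul_right (h₁ g) _)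
  -- The square root is subadditive over blocks, and 2^{iβ} = 2^{(i-r)β} 2^{rβ} turns the sum into a
  -- convolution with ratio 2^β < 1.
  rw [← sum_blocks _ strictMono_two_pow_sub_one rfl]
  refine (mul_le_mul_right (rpow_sum_le_sum_rpow _ _ (by norm_num) (by norm_num)) _).trans ?_
  rw [Finset.mul_sum]
  refine le_trans (Finset.sum_le_sum fun r hr => le_of_eq ?_)
    (Finset.sum_le_sum_of_subset (Finset.range_mono (Nat.le_succ i)))
  rw [← mul_assoc, ← ENNReal.rpow_natCast, ← ENNReal.rpow_mul, ← two_rpow_add]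
  congr 2
  rw [Nat.cast_sub (Finset.mem_range.1 hr).le]
  ring

theorem lqNorm_partial_sqrt_add_decay_le {q : ℝ≥0∞} (h0 : q ≠ 0) {α : ℝ} (hα : α + recip q < 0) :
    ∃ C : ℝ≥0∞, C ≠ ∞ ∧ ∀ g : ℕ → ℝ≥0∞,
      lqNorm q (fun i => 2 ^ (i * (α + recip q)) *
        ((∑ m ∈ Finset.range (2 ^ i - 1), g m ^ (2 : ℝ)) ^ (1 / 2 : ℝ) +
          ∑' m : ℕ, 2 ^ (-(m : ℝ) / 4) * g m))
      ≤ C * lqNorm q (fun m => ENNReal.ofReal (((m : ℝ) + 1) ^ (α + recip (min q 2))) * g m) := by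
  obtain ⟨C₁, hC₁, h₁⟩ := lqNorm_partial_sqrt_le h0 hα
  obtain ⟨C₂, hC₂, h₂⟩ := tsum_decay_le h0 (α + recip (min q 2))
  set G := lqNorm q (fun i => (2 : ℝ≥0∞) ^ (i * (α + recip q))) with hG
  refine ⟨ENNReal.LpAddConst q * (C₁ + C₂ * G), ENNReal.mul_ne_top (ENNReal.LpAddConst_lt_top q).ne
    (ENNReal.add_ne_top.2 ⟨hC₁, ENNReal.mul_ne_top hC₂ (lqNorm_geometric_ne_top h0 hα)⟩), fun g => ?_⟩
  refine (le_of_eq (congrArg (lqNorm q) (funext fun i => mul_add _ _ _))).trans ?_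
  refine (lqNorm_add_le q _ _).trans ?_
  rw [mul_assoc, add_mul]
  gcongr
  · exact h₁ g
  · simp_rw [mul_comm _ (∑' m : ℕ, 2 ^ (-(m : ℝ) / 4) * g m)]
    rw [lqNorm_const_mul h0, mul_right_comm]
    gcongr
    exact h₂ g

/-! ### Bounding Lorentz–Zygmund sequence norms by partial `ℓ²` sums -/

/-- Subtracting 2 makes the first endpoint 2^{2^0} - 2 equal to 0. -/
theorem strictMono_two_pow_two_pow_sub_two : StrictMono fun r : ℕ => 2 ^ 2 ^ r - 2 :=
  strictMono_nat_of_lt_succ fun r => by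
    have h₁ : 2 ^ 1 ≤ 2 ^ 2 ^ r := Nat.pow_le_pow_right two_pos Nat.one_le_two_pow
    have h₂ : 2 ^ 2 ^ r < 2 ^ 2 ^ (r + 1) :=
      Nat.pow_lt_pow_right (by norm_num) (Nat.pow_lt_pow_right (by norm_num) (Nat.lt_succ_self r))
    omega

theorem one_add_log_comparable {i j : ℕ}
    (hj : j ∈ Finset.Ico (2 ^ 2 ^ i - 2) (2 ^ 2 ^ (i + 1) - 2)) :
    1 + Real.log ((j + 1 : ℕ) : ℝ) ≤ 3 * 2 ^ i ∧ 2 ^ i ≤ 3 * (1 + Real.log ((j + 1 : ℕ) : ℝ)) := by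
  obtain ⟨h₁, h₂⟩ := Finset.mem_Ico.1 hj
  have hl2 := Real.log_two_gt_d9
  have hl2' := Real.log_two_lt_d9
  have hi : (1 : ℝ) ≤ 2 ^ i := one_le_pow₀ (by norm_num)
  constructor
  · have hle : ((j + 1 : ℕ) : ℝ) ≤ 2 ^ 2 ^ (i + 1) := by
      exact_mod_cast (show j + 1 ≤ 2 ^ 2 ^ (i + 1) by omega)
    have := Real.log_le_log (by positivity) hle
    rw [Real.log_pow] at this
    push_cast [pow_succ] at this ⊢
    nlinarith
  · have hpos : 2 ^ i - 1 + 1 = 2 ^ i := Nat.sub_add_cancel Nat.one_le_two_pow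
    -- Only j + 1 ≥ 2^{2^i} - 1 is known; lowering the exponent by one absorbs the -1.
    have hle : 2 ^ (2 ^ i - 1) ≤ j + 1 := by
      have e : 2 ^ 2 ^ i = 2 ^ (2 ^ i - 1) * 2 := by rw [← pow_succ, hpos]
      have := Nat.one_le_two_pow (n := 2 ^ i - 1)
      omega
    have hle' : (2 : ℝ) ^ (2 ^ i - 1) ≤ ((j + 1 : ℕ) : ℝ) := by exact_mod_cast hle
    have := Real.log_le_log (by positivity) hle'
    rw [Real.log_pow, Nat.cast_sub Nat.one_le_two_pow] at this
    push_cast at this ⊢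
    nlinarith

theorem sum_inv_le (i : ℕ) :
    ∑ j ∈ Finset.Ico (2 ^ 2 ^ i - 2) (2 ^ 2 ^ (i + 1) - 2), ENNReal.ofReal (((j + 1 : ℕ) : ℝ)⁻¹)
      ≤ 3 * 2 ^ (i : ℝ) := by
  have hl2' := Real.log_two_lt_d9
  have hi : (1 : ℝ) ≤ 2 ^ i := one_le_pow₀ (by norm_num)
  calc _ ≤ ∑ j ∈ Finset.range (2 ^ 2 ^ (i + 1)), ENNReal.ofReal (((j + 1 : ℕ) : ℝ)⁻¹) := by
        refine Finset.sum_le_sum_of_subset fun j hj => Finset.mem_range.2 ?_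
        have := (Finset.mem_Ico.1 hj).2
        omega
    _ = ENNReal.ofReal (∑ j ∈ Finset.range (2 ^ 2 ^ (i + 1)), ((j + 1 : ℕ) : ℝ)⁻¹) := by
        rw [ENNReal.ofReal_sum_of_nonneg fun _ _ => by positivity]
    _ ≤ ENNReal.ofReal (3 * 2 ^ i) := by
        refine ENNReal.ofReal_le_ofReal ?_
        have := harmonic_le_one_add_log (2 ^ 2 ^ (i + 1))
        rw [harmonic] at this
        push_cast [Real.log_pow] at this ⊢
        refine this.trans ?_
        rw [pow_succ]
        nlinarith
    _ = _ := by
        rw [ENNReal.ofReal_mul (by norm_num), two_rpow_eq_ofReal, Real.rpow_natCast]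
        simp

theorem sqrt_mul_le_partial {d : ℕ → ℝ≥0∞} (hd : Antitone d) {j n : ℕ} (hj : j < n) :
    ENNReal.ofReal (((j + 1 : ℕ) : ℝ)) ^ (1 / 2 : ℝ) * d j
      ≤ (∑ k ∈ Finset.range n, d k ^ (2 : ℝ)) ^ (1 / 2 : ℝ) := by
  refine le_of_rpow_le two_pos ?_
  rw [ENNReal.mul_rpow_of_nonneg _ _ two_pos.le, ← ENNReal.rpow_mul, ← ENNReal.rpow_mul,
    one_div_mul_cancel two_ne_zero, ENNReal.rpow_one, ENNReal.rpow_one, ENNReal.ofReal_natCast]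
  calc ((j + 1 : ℕ) : ℝ≥0∞) * d j ^ (2 : ℝ) = ∑ k ∈ Finset.range (j + 1), d j ^ (2 : ℝ) := by simp
    _ ≤ ∑ k ∈ Finset.range (j + 1), d k ^ (2 : ℝ) := by
        refine Finset.sum_le_sum fun k hk => ENNReal.rpow_le_rpow (hd ?_) two_pos.le
        exact Nat.lt_succ_iff.1 (Finset.mem_range.1 hk)
    _ ≤ _ := Finset.sum_le_sum_of_subset (Finset.range_mono hj)

/-- Each term is (k^{1/2} d)^{p-2} d^2 with k = j + 1. Monotonicity bounds the first factor by the
partial ℓ^2 norm, and the second is summed. -/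
theorem sum_block_ge_two_le {d : ℕ → ℝ≥0∞} (hd : Antitone d) {p : ℝ} (hp : 2 ≤ p)
    {s : Finset ℕ} {n : ℕ} (hs : s ⊆ Finset.range n) :
    ∑ j ∈ s, (ENNReal.ofReal (((j + 1 : ℕ) : ℝ) ^ (1 / 2 - 1 / p)) * d j) ^ p
      ≤ ((∑ k ∈ Finset.range n, d k ^ (2 : ℝ)) ^ (1 / 2 : ℝ)) ^ p := by
  set A := ∑ k ∈ Finset.range n, d k ^ (2 : ℝ) with hA
  have hp0 : 0 < p := by linarith
  calc _ ≤ ∑ j ∈ s, (A ^ (1 / 2 : ℝ)) ^ (p - 2) * d j ^ (2 : ℝ) := by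
        refine Finset.sum_le_sum fun j hj => ?_
        refine le_trans (le_of_eq ?_) (mul_le_mul_left (ENNReal.rpow_le_rpow
          (sqrt_mul_le_partial hd (Finset.mem_range.1 (hs hj))) (by linarith : 0 ≤ p - 2)) _)
        rw [ENNReal.mul_rpow_of_nonneg _ _ hp0.le, ENNReal.mul_rpow_of_nonneg _ _ (by linarith),
          mul_assoc, ← ENNReal.rpow_add_of_nonneg _ _ (by linarith) two_pos.le,
          ← ENNReal.ofReal_rpow_of_pos (by positivity), ← ENNReal.rpow_mul, ← ENNReal.rpow_mul]
        congr 2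
        · field_simp
        · ring
    _ = (A ^ (1 / 2 : ℝ)) ^ (p - 2) * ∑ j ∈ s, d j ^ (2 : ℝ) := by rw [Finset.mul_sum]
    _ ≤ (A ^ (1 / 2 : ℝ)) ^ (p - 2) * A := by
        gcongr
        exact Finset.sum_le_sum_of_subset hs
    _ = _ := by
        conv_lhs => rw [← ENNReal.rpow_one A, ← ENNReal.rpow_mul, ← ENNReal.rpow_mul, ← ENNReal.rpow_add_of_nonneg _ _ (by linarith) (by norm_num)]
        rw [← ENNReal.rpow_mul]
        congr 1
        ring

/-- Hölder with exponents 2/(2-p) and 2/p, which turns the weight into exactly 1/k. -/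
theorem sum_block_lt_two_le {d : ℕ → ℝ≥0∞} {p : ℝ} (hp0 : 0 < p) (hp : p < 2)
    {s : Finset ℕ} {n : ℕ} (hs : s ⊆ Finset.range n) :
    ∑ j ∈ s, (ENNReal.ofReal (((j + 1 : ℕ) : ℝ) ^ (1 / 2 - 1 / p)) * d j) ^ p
      ≤ (∑ j ∈ s, ENNReal.ofReal (((j + 1 : ℕ) : ℝ)⁻¹)) ^ (1 - p / 2) *
        ((∑ k ∈ Finset.range n, d k ^ (2 : ℝ)) ^ (1 / 2 : ℝ)) ^ p := by
  have hp2 : 0 < 2 - p := by linarith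
  have hconj : (2 / (2 - p)).HolderConjugate (2 / p) := by
    rw [Real.holderConjugate_iff]
    refine ⟨by rw [lt_div_iff₀ hp2]; linarith, ?_⟩
    field_simp
    ring
  have h := ENNReal.inner_le_Lp_mul_Lq s
    (fun j => ENNReal.ofReal (((j + 1 : ℕ) : ℝ)) ^ (p / 2 - 1)) (fun j => d j ^ p) hconj
  have e₁ : ∀ j : ℕ, (ENNReal.ofReal (((j + 1 : ℕ) : ℝ) ^ (1 / 2 - 1 / p)) * d j) ^ p
      = ENNReal.ofReal (((j + 1 : ℕ) : ℝ)) ^ (p / 2 - 1) * d j ^ p := fun j => by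
    rw [ENNReal.mul_rpow_of_nonneg _ _ hp0.le, ← ENNReal.ofReal_rpow_of_pos (by positivity),
      ← ENNReal.rpow_mul]
    congr 2
    field_simp
  have e₂ : ∀ j : ℕ, (ENNReal.ofReal (((j + 1 : ℕ) : ℝ)) ^ (p / 2 - 1)) ^ (2 / (2 - p))
      = ENNReal.ofReal (((j + 1 : ℕ) : ℝ)⁻¹) := fun j => by
    rw [← ENNReal.rpow_mul, ENNReal.ofReal_inv_of_pos (by positivity), ← ENNReal.rpow_neg_one]
    congr 1
    field_simp
    ring
  have e₃ : ∀ j : ℕ, (d j ^ p) ^ (2 / p) = d j ^ (2 : ℝ) := fun j => by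
    rw [← ENNReal.rpow_mul]
    congr 1
    field_simp
  simp_rw [e₁]
  refine h.trans ?_
  simp_rw [e₂, e₃]
  rw [one_div_div, one_div_div, ← ENNReal.rpow_mul, show 1 / 2 * p = p / 2 by ring,
    show (2 - p) / 2 = 1 - p / 2 by ring]
  gcongr

theorem log_weight_le {i j : ℕ} (hj : j ∈ Finset.Ico (2 ^ 2 ^ i - 2) (2 ^ 2 ^ (i + 1) - 2))
    (s b : ℝ) :
    ENNReal.ofReal (((j + 1 : ℕ) : ℝ) ^ s * (1 + Real.log ((j + 1 : ℕ) : ℝ)) ^ b)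
      ≤ ENNReal.ofReal (3 ^ |b|) * 2 ^ (i * b) * ENNReal.ofReal (((j + 1 : ℕ) : ℝ) ^ s) := by
  obtain ⟨h₁, h₂⟩ := one_add_log_comparable hj
  have hlog : 0 ≤ Real.log ((j + 1 : ℕ) : ℝ) := Real.log_natCast_nonneg _
  rw [two_rpow_eq_ofReal, ← ENNReal.ofReal_mul (by positivity), ← ENNReal.ofReal_mul (by positivity)]
  refine ENNReal.ofReal_le_ofReal ?_
  have := rpow_le_of_comparable (by positivity) (by positivity) three_pos h₁ h₂ b
  rw [Real.rpow_mul two_pos.le, Real.rpow_natCast, mul_comm]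
  gcongr

/-- On block i the logarithmic weight is of order 2^{ib}. For q ≥ 2 nothing is lost; for q < 2 the
harmonic sum, of order 2^i, costs 2^{i(1/q-1/2)}. In both cases the total exponent is α + 1/q. -/
theorem lqNorm_log_weight_le {q : ℝ≥0∞} (h0 : q ≠ 0) (α : ℝ) :
    ∃ C : ℝ≥0∞, C ≠ ∞ ∧ ∀ d : ℕ → ℝ≥0∞, Antitone d →
      lqNorm q (fun j => ENNReal.ofReal (((j + 1 : ℕ) : ℝ) ^ (recip 2 - recip q) *
          (1 + Real.log ((j + 1 : ℕ) : ℝ)) ^ (α + recip (max q 2))) * d j)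
      ≤ C * lqNorm q (fun i => 2 ^ (i * (α + recip q)) *
          (∑ k ∈ Finset.range (2 ^ 2 ^ (i + 1)), d k ^ (2 : ℝ)) ^ (1 / 2 : ℝ)) := by
  set b := α + recip (max q 2) with hb
  set K := ENNReal.ofReal (3 ^ |b|) with hK
  have hKt : K ≠ ∞ := by simp [hK]
  have hsub : ∀ i : ℕ, Finset.Ico (2 ^ 2 ^ i - 2) (2 ^ 2 ^ (i + 1) - 2)
      ⊆ Finset.range (2 ^ 2 ^ (i + 1)) := fun i j hj =>
    Finset.mem_range.2 (by have := (Finset.mem_Ico.1 hj).2; omega)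
  by_cases hqt : q = ∞
  · subst hqt
    refine ⟨K, hKt, fun d hd => ?_⟩
    have hr0 : recip ∞ = 0 := by simp [recip]
    rw [lqNorm_top]
    refine iSup_le fun j => ?_
    obtain ⟨i, hi⟩ := exists_mem_block _ strictMono_two_pow_two_pow_sub_two rfl j
    refine le_trans ?_ (mul_le_mul_right (le_lqNorm (by simp) _ i) K)
    refine (mul_le_mul_left (log_weight_le hi _ b) _).trans ?_
    have hbα : b = α + recip ∞ := by simp [hb]
    rw [hbα, mul_assoc, mul_assoc, ← hbα]
    gcongr
    rw [hr0, recip_two, sub_zero, ← ENNReal.ofReal_rpow_of_pos (by positivity)]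
    exact sqrt_mul_le_partial hd (Finset.mem_range.1 (hsub i hi))
  · have hp := ENNReal.toReal_pos h0 hqt
    have hep : recip q = 1 / q.toReal := by rw [recip, ENNReal.toReal_inv, one_div]
    have hle2 : q.toReal ≤ 2 ↔ q ≤ 2 := by
      conv_lhs => rw [← ENNReal.toReal_ofNat 2]
      rw [ENNReal.toReal_le_toReal hqt (by simp)]
    set p := q.toReal with hpq
    obtain ⟨D, hD, hcore⟩ : ∃ D : ℝ≥0∞, D ≠ ∞ ∧ ∀ d : ℕ → ℝ≥0∞, Antitone d → ∀ i : ℕ,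
        2 ^ (i * b * p) * ∑ j ∈ Finset.Ico (2 ^ 2 ^ i - 2) (2 ^ 2 ^ (i + 1) - 2),
          (ENNReal.ofReal (((j + 1 : ℕ) : ℝ) ^ (1 / 2 - 1 / p)) * d j) ^ p
        ≤ D * (2 ^ (i * (α + recip q)) *
          (∑ k ∈ Finset.range (2 ^ 2 ^ (i + 1)), d k ^ (2 : ℝ)) ^ (1 / 2 : ℝ)) ^ p := by
      rcases le_or_gt 2 q with h2 | h2
      · have h2p : 2 ≤ p := by
          rcases le_total p 2 with h | h
          · have := le_antisymm h2 (hle2.1 h)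
            simp only [p, ← this]
            simp
          · exact h
        refine ⟨1, ENNReal.one_ne_top, fun d hd i => ?_⟩
        rw [one_mul, ENNReal.mul_rpow_of_nonneg _ _ hp.le, ← ENNReal.rpow_mul, hb, max_eq_left h2]
        gcongr
        exact sum_block_ge_two_le hd h2p (hsub i)
      · have h2p : p < 2 := lt_of_le_of_ne (hle2.2 h2.le) fun h => by
          rw [hpq] at h
          have : q = 2 := by rw [← ENNReal.ofReal_toReal hqt, h]; simp
          exact h2.ne this
        refine ⟨3 ^ (1 - p / 2), ENNReal.rpow_ne_top_of_nonneg (by linarith) (by simp),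
          fun d hd i => ?_⟩
        have hS := ENNReal.rpow_le_rpow (sum_inv_le i) (by linarith : 0 ≤ 1 - p / 2)
        rw [ENNReal.mul_rpow_of_nonneg _ _ (by linarith), ← ENNReal.rpow_mul] at hS
        refine (mul_le_mul_right ((sum_block_lt_two_le hp h2p (hsub i)).trans
          (mul_le_mul_left hS _)) _).trans (le_of_eq ?_)
        have e₁ : (i : ℝ) * (α + recip q) * p = i * b * p + i * (1 - p / 2) := by
          rw [hb, max_eq_right h2.le, recip_two, hep]
          field_simp
          ring
        rw [ENNReal.mul_rpow_of_nonneg _ _ hp.le, ← ENNReal.rpow_mul 2, e₁, two_rpow_add]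
        ring
    refine ⟨K * D ^ (1 / p), ENNReal.mul_ne_top hKt (ENNReal.rpow_ne_top_of_nonneg (by positivity) hD),
      fun d hd => le_of_rpow_le hp ?_⟩
    rw [ENNReal.mul_rpow_of_nonneg _ _ hp.le, ENNReal.mul_rpow_of_nonneg _ _ hp.le,
      ← ENNReal.rpow_mul D, one_div_mul_cancel hp.ne', ENNReal.rpow_one, lqNorm_rpow h0 hqt,
      lqNorm_rpow h0 hqt, ← tsum_blocks _ strictMono_two_pow_two_pow_sub_two rfl
        (fun j : ℕ => (ENNReal.ofReal (((j + 1 : ℕ) : ℝ) ^ (recip 2 - recip q) *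
          (1 + Real.log ((j + 1 : ℕ) : ℝ)) ^ b) * d j) ^ q.toReal), mul_assoc,
      ← ENNReal.tsum_mul_left, ← ENNReal.tsum_mul_left]
    refine ENNReal.tsum_le_tsum fun i => ?_
    refine le_trans ?_ (mul_le_mul_right (hcore d hd i) _)
    rw [← mul_assoc, Finset.mul_sum]
    refine Finset.sum_le_sum fun j hj => ?_
    rw [ENNReal.rpow_mul, ← ENNReal.mul_rpow_of_nonneg _ _ hp.le,
      ← ENNReal.mul_rpow_of_nonneg _ _ hp.le, ← mul_assoc]
    gcongr
    rw [recip_two, hep]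
    exact log_weight_le hj _ b

theorem lzSeqNorm_le {q : ℝ≥0∞} (h0 : q ≠ 0) (α : ℝ) :
    ∃ C : ℝ≥0∞, C ≠ ∞ ∧ ∀ (ι : Type) (c : ι → ℂ),
      max (lzSeqNorm 2 q (α + recip (max q 2)) c) (lzSeqNorm 2 (max q 2) (α + recip q) c)
      ≤ C * lqNorm q (fun i => 2 ^ (i * (α + recip q)) *
          (∑ k ∈ Finset.range (2 ^ 2 ^ (i + 1)), seqRearr c (k + 1) ^ (2 : ℝ)) ^ (1 / 2 : ℝ)) := by
  obtain ⟨C₁, hC₁, h₁⟩ := lqNorm_log_weight_le h0 α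
  have hanti : ∀ (ι : Type) (c : ι → ℂ), Antitone fun k => seqRearr c (k + 1) :=
    fun ι c a b hab => seqRearr_antitone c (Nat.succ_le_succ hab)
  rcases le_total 2 q with h2 | h2
  · refine ⟨C₁, hC₁, fun ι c => ?_⟩
    rw [max_eq_left h2] at h₁ ⊢
    rw [max_self]
    exact h₁ _ (hanti ι c)
  -- For q < 2, the second norm is the exponent-2 case with α replaced by α + 1/q - 1/2, which keeps
  -- the weight 2^{i(α+1/q)}; then ℓ^q embeds in ℓ^2.
  · obtain ⟨C₂, hC₂, h₂⟩ := lqNorm_log_weight_le (q := 2) two_ne_zero (α + recip q - recip 2)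
    refine ⟨max C₁ C₂, (max_lt hC₁.lt_top hC₂.lt_top).ne, fun ι c => max_le ?_ ?_⟩
    · exact (h₁ _ (hanti ι c)).trans (mul_le_mul_left (le_max_left _ _) _)
    · have := h₂ _ (hanti ι c)
      rw [max_self, sub_add_cancel] at this
      rw [max_eq_right h2]
      refine this.trans ?_
      gcongr
      · exact le_max_right _ _
      · exact lqNorm_anti_exponent h0 h2 (by simp) _

/-! ### The Fourier map between Lorentz–Zygmund spaces -/

theorem exists_two_pow_scale {M : ℝ} (hM : 1 ≤ M) :
    ∃ j : ℕ, M ≤ 2 ^ ((2 : ℝ) ^ j / 2) ∧ (2 : ℝ) ^ j ≤ 6 * (1 + Real.log M) := by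
  have hlog := Real.log_nonneg hM
  have hl2 := Real.log_two_gt_d9
  -- The factor 3 suffices because (3/2) log 2 > 1.
  obtain ⟨n, h₁, h₂⟩ := exists_nat_pow_near (x := 1 + 3 * Real.log M) (y := 2)
    (by linarith) (by norm_num)
  refine ⟨n + 1, ?_, by rw [pow_succ]; linarith⟩
  rw [← Real.log_le_log_iff (by linarith) (by positivity), Real.log_rpow two_pos]
  nlinarith

/-- From log M ≤ a M^{1/a}. It makes the logarithmic bound imply the one with the minimum. -/
theorem one_add_log_rpow_le {a : ℝ} (ha : 0 < a) {M : ℝ} (hM : 1 ≤ M) :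
    (1 + Real.log M) ^ a ≤ (1 + a) ^ a * M := by
  have h₁ := Real.log_le_rpow_div (by linarith : 0 ≤ M) (one_div_pos.2 ha)
  have h₂ : 1 ≤ M ^ (1 / a) := Real.one_le_rpow hM (by positivity)
  have h₃ : 1 + Real.log M ≤ (1 + a) * M ^ (1 / a) := by
    rw [div_div_eq_mul_div, div_one, mul_comm] at h₁
    linarith
  have hlog := Real.log_nonneg hM
  calc (1 + Real.log M) ^ a ≤ ((1 + a) * M ^ (1 / a)) ^ a := by gcongr
    _ = (1 + a) ^ a * M := by
        rw [Real.mul_rpow (by positivity) (by positivity), ← Real.rpow_mul (by linarith),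
          one_div_mul_cancel ha.ne', Real.rpow_one]

theorem one_le_of_orthonormal {ι : Type} [Nonempty ι] {φ : ι → Lp ℂ 2 unitVolume} {M : ℝ≥0}
    (hφ : Orthonormal ℂ φ) (hM : ∀ n, eLpNorm (φ n) ∞ unitVolume ≤ M) : (1 : ℝ) ≤ M := by
  obtain ⟨n⟩ := ‹Nonempty ι›
  have h₁ : ‖φ n‖ₑ = 1 := by rw [← ofReal_norm, hφ.1 n]; simp
  rw [Lp.enorm_def] at h₁
  have h₂ := (eLpNorm_le_eLpNorm_of_exponent_le (p := 2) (q := ∞) le_top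
    (Lp.aestronglyMeasurable (φ n))).trans (hM n)
  rw [h₁] at h₂
  exact_mod_cast h₂

theorem sqrt_sum_sq_fourierMap_le {ι : Type} {φ : ι → Lp ℂ 2 unitVolume} (hφ : Orthonormal ℂ φ)
    {M : ℝ≥0} (hM : ∀ n, eLpNorm (φ n) ∞ unitVolume ≤ M) {f : ℝ →ₘ[unitVolume] ℂ}
    (hg : ∀ m, dyadicRearr f m ≠ ∞) (hZ : ∑' m : ℕ, 2 ^ (-(m : ℝ) / 4) * dyadicRearr f m ≠ ∞)
    {j : ℕ} (hj : (M : ℝ) ≤ 2 ^ ((2 : ℝ) ^ j / 2)) (i : ℕ) :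
    (∑ k ∈ Finset.range (2 ^ 2 ^ (i + 1)), seqRearr (fourierMap φ f) (k + 1) ^ (2 : ℝ)) ^ (1 / 2 : ℝ)
      ≤ 6 * ((∑ m ∈ Finset.range (2 ^ (i + (j + 3)) - 1), dyadicRearr f m ^ (2 : ℝ)) ^ (1 / 2 : ℝ) +
        ∑' m : ℕ, 2 ^ (-(m : ℝ) / 4) * dyadicRearr f m) := by
  set r := i + (j + 3) with hr
  set Z := ∑' m : ℕ, 2 ^ (-(m : ℝ) / 4) * dyadicRearr f m with hZdef
  set Q := ∑ m ∈ Finset.range (2 ^ r - 1), dyadicRearr f m ^ (2 : ℝ) with hQ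
  have hr4 : 4 ≤ 2 ^ r := by
    calc 4 = 2 ^ 2 := by norm_num
      _ ≤ 2 ^ r := Nat.pow_le_pow_right two_pos (by omega)
  obtain ⟨J, hJ⟩ : ∃ J, 2 ^ r - 1 = J + 1 := ⟨2 ^ r - 2, by omega⟩
  have hQJ : Q = ∑ m ∈ Finset.range (J + 1), dyadicRearr f m ^ 2 := by
    rw [hQ, hJ]
    simp
  -- The offset 3 in r makes √N·M ≤ 2^{2^r/4}, which a factor 2^{-m/4} compensates for m ≥ 2^r - 1;
  -- the -1 accounts for the 2 in `hRT`.
  have hexp : (2 : ℝ) ^ (i + 1) + 2 ^ j ≤ 2 ^ r / 2 := by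
    have a₁ : (1 : ℝ) ≤ 2 ^ i := one_le_pow₀ (by norm_num)
    have a₂ : (1 : ℝ) ≤ 2 ^ j := one_le_pow₀ (by norm_num)
    rw [hr, pow_add, pow_add, pow_add]
    nlinarith
  have hJr : ((J + 1 : ℕ) : ℝ) = 2 ^ r - 1 := by
    rw [← hJ, Nat.cast_sub Nat.one_le_two_pow]
    simp
  have hQt : Q ≠ ∞ := by
    rw [hQ]
    exact ENNReal.sum_ne_top.2 fun m _ => ENNReal.rpow_ne_top_of_nonneg two_pos.le (hg m)
  set T := ∑' m, 2 ^ (-((J + 1 + m : ℕ) : ℝ) / 2) * dyadicRearr f (J + 1 + m) with hT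
  set R : ℝ≥0∞ := 2 ^ (((2 : ℝ) ^ (i + 1) + 2 ^ j) / 2) with hR
  have hRT : R * T ≤ 2 * Z := by
    calc R * T ≤ ∑' m : ℕ, 2 * (2 ^ (-((J + 1 + m : ℕ) : ℝ) / 4) * dyadicRearr f (J + 1 + m)) := by
          rw [hT, ← ENNReal.tsum_mul_left]
          refine ENNReal.tsum_le_tsum fun m => ?_
          rw [← mul_assoc, ← mul_assoc, hR, ← two_rpow_add]
          gcongr
          conv_rhs => rw [← ENNReal.rpow_one 2, ← ENNReal.rpow_mul, ← two_rpow_add]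
          refine ENNReal.rpow_le_rpow_of_exponent_le (by norm_num) ?_
          have : ((J + 1 + m : ℕ) : ℝ) = 2 ^ r - 1 + m := by rw [Nat.cast_add, hJr]
          rw [this]
          have : (0 : ℝ) ≤ m := by positivity
          linarith
      _ ≤ _ := by
          rw [ENNReal.tsum_mul_left]
          gcongr
          exact ENNReal.tsum_comp_le_tsum_of_injective (add_right_injective (J + 1))
            (fun m : ℕ => 2 ^ (-(m : ℝ) / 4) * dyadicRearr f m)
  have hTt : T ≠ ∞ := by
    refine ne_top_of_le_ne_top (ENNReal.mul_ne_top (by simp) hZ : 2 * Z ≠ ∞) (le_trans ?_ hRT)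
    refine le_mul_of_one_le_left' ?_
    rw [hR]
    exact ENNReal.one_le_rpow (by norm_num) (by positivity)
  have h₀ := setLIntegral_sq_le f J
  have h₁ := setLIntegral_tail_le f J
  rw [← hQJ] at h₀
  have hmain := sum_sq_fourierMap_le hφ hM
    (ne_top_of_le_ne_top (ENNReal.mul_ne_top (by simp) hQt) h₀)
    (ne_top_of_le_ne_top (ENNReal.mul_ne_top (by simp) hTt) h₁) (2 ^ 2 ^ (i + 1))
  have hNM : ((2 ^ 2 ^ (i + 1) : ℕ) : ℝ≥0∞) * (M : ℝ≥0∞) ^ 2 ≤ R ^ 2 := by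
    have e₁ : ((2 ^ 2 ^ (i + 1) : ℕ) : ℝ≥0∞) = 2 ^ ((2 : ℝ) ^ (i + 1)) := by
      have : (2 : ℝ) ^ (i + 1) = ((2 ^ (i + 1) : ℕ) : ℝ) := by push_cast; ring
      rw [this, ENNReal.rpow_natCast]
      push_cast
      ring
    have e₂ : (M : ℝ≥0∞) ≤ 2 ^ ((2 : ℝ) ^ j / 2) := by
      rw [two_rpow_eq_ofReal, ← ENNReal.ofReal_coe_nnreal]
      exact ENNReal.ofReal_le_ofReal hj
    calc _ ≤ 2 ^ ((2 : ℝ) ^ (i + 1)) * ((2 : ℝ≥0∞) ^ ((2 : ℝ) ^ j / 2)) ^ 2 := by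
          rw [e₁]
          gcongr
      _ = R ^ 2 := by
          rw [hR, ← ENNReal.rpow_natCast, ← ENNReal.rpow_natCast, ← ENNReal.rpow_mul,
            ← ENNReal.rpow_mul, ← two_rpow_add]
          congr 1
          push_cast
          ring
  refine le_of_rpow_le two_pos ?_
  rw [← ENNReal.rpow_mul, one_div_mul_cancel two_ne_zero, ENNReal.rpow_one]
  set P := Q ^ (1 / 2 : ℝ) with hP
  have hP2 : P ^ 2 = Q := by
    rw [hP, ← ENNReal.rpow_natCast, ← ENNReal.rpow_mul]
    simp
  simp_rw [ENNReal.rpow_ofNat]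
  calc _ ≤ 2 * (2 * Q) + 2 * (((2 ^ 2 ^ (i + 1) : ℕ) : ℝ≥0∞) * (M * (2 * T)) ^ 2) := by
        refine hmain.trans ?_
        gcongr
    _ = 4 * P ^ 2 + 8 * ((((2 ^ 2 ^ (i + 1) : ℕ) : ℝ≥0∞) * M ^ 2) * T ^ 2) := by
        rw [hP2]
        ring
    _ ≤ 4 * P ^ 2 + 8 * (R ^ 2 * T ^ 2) := by gcongr
    _ = 4 * P ^ 2 + 8 * (R * T) ^ 2 := by ring
    _ ≤ 4 * P ^ 2 + 8 * (2 * Z) ^ 2 := by gcongr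
    _ = 4 * P ^ 2 + 32 * Z ^ 2 := by ring
    -- Nonnegative terms are added to complete the square 36(P + Z)^2.
    _ ≤ (4 * P ^ 2 + 32 * Z ^ 2) + (32 * P ^ 2 + 4 * Z ^ 2 + 72 * (P * Z)) := le_self_add
    _ = (6 * (P + Z)) ^ 2 := by ring

theorem lqNorm_fourierMap_le {q : ℝ≥0∞} (h0 : q ≠ 0) {α : ℝ} (hα : α + recip q < 0) :
    ∃ C : ℝ≥0∞, C ≠ ∞ ∧ ∀ (ι : Type) (φ : ι → Lp ℂ 2 unitVolume) (M : ℝ≥0),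
      Orthonormal ℂ φ → (∀ n, eLpNorm (φ n) ∞ unitVolume ≤ M) → (1 : ℝ) ≤ M →
      ∀ f ∈ LZFun 2 q (α + recip (min q 2)), Integrable f unitVolume ∧
        lqNorm q (fun i => 2 ^ (i * (α + recip q)) * (∑ k ∈ Finset.range (2 ^ 2 ^ (i + 1)),
          seqRearr (fourierMap φ f) (k + 1) ^ (2 : ℝ)) ^ (1 / 2 : ℝ))
        ≤ C * ENNReal.ofReal ((1 + Real.log M) ^ |α|) * lzFunNorm 2 q (α + recip (min q 2)) f := by
  set β := α + recip q with hβ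
  set γ := α + recip (min q 2) with hγ
  obtain ⟨C₁, hC₁, h₁⟩ := lqNorm_dyadicRearr_le h0 γ
  obtain ⟨C₂, hC₂, h₂⟩ := tsum_decay_le h0 γ
  obtain ⟨C₃, hC₃, h₃⟩ := lqNorm_partial_sqrt_add_decay_le h0 hα
  have he : 0 ≤ recip q := ENNReal.toReal_nonneg
  have hα0 : α < 0 := by linarith
  refine ⟨6 * ENNReal.ofReal (48 ^ |α|) * C₃ * C₁, ENNReal.mul_ne_top (ENNReal.mul_ne_top
    (ENNReal.mul_ne_top (by simp) (by simp)) hC₃) hC₁, fun ι φ M hφ hM hM1 f hf => ?_⟩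
  have hWt : lqNorm q (fun m => ENNReal.ofReal (((m : ℝ) + 1) ^ γ) * dyadicRearr f m) ≠ ∞ :=
    ne_top_of_le_ne_top (ENNReal.mul_ne_top hC₁ (LT.lt.ne hf)) (h₁ f)
  have hg : ∀ m, dyadicRearr f m ≠ ∞ := fun m => by
    have := ne_top_of_le_ne_top hWt (le_lqNorm h0 _ m)
    rintro h
    rw [h, ENNReal.mul_top] at this
    · exact this rfl
    · exact (ENNReal.ofReal_pos.2 (by positivity)).ne'
  have hZ := ne_top_of_le_ne_top (ENNReal.mul_ne_top hC₂ hWt) (h₂ (dyadicRearr f))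
  constructor
  -- Integrability needs no tuned level: cutting at J = 0 suffices.
  · have a₀ := setLIntegral_sq_le f 0
    have a₁ := setLIntegral_tail_le f 0
    have b₀ : 2 * ∑ m ∈ Finset.range (0 + 1), dyadicRearr f m ^ 2 ≠ ∞ :=
      ENNReal.mul_ne_top (by simp) (ENNReal.sum_ne_top.2 fun m _ => ENNReal.pow_ne_top (hg m))
    have b₁ : 2 * ∑' m, 2 ^ (-((0 + 1 + m : ℕ) : ℝ) / 2) * dyadicRearr f (0 + 1 + m) ≠ ∞ := by
      refine ENNReal.mul_ne_top (by simp) (ne_top_of_le_ne_top hZ (le_trans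
        (ENNReal.tsum_le_tsum fun m => ?_)
        (ENNReal.tsum_comp_le_tsum_of_injective (add_right_injective (0 + 1))
          (fun m : ℕ => 2 ^ (-(m : ℝ) / 4) * dyadicRearr f m))))
      refine mul_le_mul_left (ENNReal.rpow_le_rpow_of_exponent_le (by norm_num) ?_) _
      have : (0 : ℝ) ≤ ((0 + 1 + m : ℕ) : ℝ) := by positivity
      linarith
    obtain ⟨c₀, c₁⟩ := integrable_of_split (ne_top_of_le_ne_top b₀ a₀) (ne_top_of_le_ne_top b₁ a₁)
    refine ((c₀.integrable (by norm_num)).add c₁).congr (Filter.Eventually.of_forall fun x => ?_)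
    exact (indicator_split f _ x).symm
  · obtain ⟨j, hj, hj'⟩ := exists_two_pow_scale hM1
    set U : ℕ → ℝ≥0∞ := fun i => 2 ^ (i * β) *
      ((∑ m ∈ Finset.range (2 ^ i - 1), dyadicRearr f m ^ (2 : ℝ)) ^ (1 / 2 : ℝ) +
        ∑' m : ℕ, 2 ^ (-(m : ℝ) / 4) * dyadicRearr f m) with hU
    -- Here 48 = 8·6, from 2^3 and 2^j ≤ 6(1 + log M). Since the base is at least 1, -β ≤ |α| allows
    -- raising the exponent.
    have hscale : (2 : ℝ≥0∞) ^ (-((j + 3 : ℕ) : ℝ) * β) ≤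
        ENNReal.ofReal (48 ^ |α|) * ENNReal.ofReal ((1 + Real.log M) ^ |α|) := by
      have hlog := Real.log_nonneg hM1
      rw [two_rpow_eq_ofReal, ← ENNReal.ofReal_mul (by positivity),
        ← Real.mul_rpow (by norm_num) (by linarith)]
      refine ENNReal.ofReal_le_ofReal ?_
      have e₁ : (2 : ℝ) ^ (-((j + 3 : ℕ) : ℝ) * β) = ((2 : ℝ) ^ (j + 3)) ^ (-β) := by
        rw [← Real.rpow_natCast, ← Real.rpow_mul two_pos.le]
        ring_nf
      rw [e₁]
      have e₂ : (2 : ℝ) ^ (j + 3) ≤ 48 * (1 + Real.log M) := by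
        rw [pow_add]
        linarith
      refine (Real.rpow_le_rpow (by positivity) e₂ (by linarith)).trans
        (Real.rpow_le_rpow_of_exponent_le (by linarith) ?_)
      rw [abs_of_neg hα0]
      linarith
    calc _ ≤ lqNorm q (fun i => (6 * 2 ^ (-((j + 3 : ℕ) : ℝ) * β)) * U (i + (j + 3))) := by
          refine lqNorm_mono fun i => ?_
          refine (mul_le_mul_right (sqrt_sum_sq_fourierMap_le hφ hM hg hZ hj i) _).trans
            (le_of_eq ?_)
          have e : (i : ℝ) * β = -((j + 3 : ℕ) : ℝ) * β + ((i + (j + 3) : ℕ) : ℝ) * β := by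
            push_cast; ring
          rw [hU, e, two_rpow_add]
          ring
      _ = (6 * 2 ^ (-((j + 3 : ℕ) : ℝ) * β)) * lqNorm q (fun i => U (i + (j + 3))) :=
          lqNorm_const_mul h0 _ _
      _ ≤ (6 * (ENNReal.ofReal (48 ^ |α|) * ENNReal.ofReal ((1 + Real.log M) ^ |α|))) *
            (C₃ * (C₁ * lzFunNorm 2 q γ f)) := by
          gcongr
          exact (lqNorm_shift_le h0 U _).trans ((h₃ _).trans (mul_le_mul_right (h₁ f) _))
      _ = _ := by ring

theorem corollary3p6 (q : ℝ≥0∞) (hq : 0 < q) (α : ℝ) (hα : α < -recip q) :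
    ∃ C : ℝ, 0 < C ∧
      ∀ (ι : Type) [Countable ι] [Infinite ι] (φ : ι → Lp ℂ 2 unitVolume) (M : ℝ≥0),
        Orthonormal ℂ φ →
        (⨆ n, eLpNorm (φ n) ∞ unitVolume) = (M : ℝ≥0∞) →
        ∀ f ∈ LZFun 2 q (α + recip (min q 2)),
          Integrable f unitVolume ∧
          fourierMap φ f ∈
            LZSeq ι 2 q (α + recip (max q 2)) ∩ LZSeq ι 2 (max q 2) (α + recip q) ∧
          max (lzSeqNorm 2 q (α + recip (max q 2)) (fourierMap φ f))
              (lzSeqNorm 2 (max q 2) (α + recip q) (fourierMap φ f)) ≤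
            ENNReal.ofReal (C * min (M : ℝ) ((1 + Real.log M) ^ |α|)) *
              lzFunNorm 2 q (α + recip (min q 2)) f := by
  obtain ⟨C₁, hC₁, h₁⟩ := lzSeqNorm_le hq.ne' α
  obtain ⟨C₂, hC₂, h₂⟩ := lqNorm_fourierMap_le hq.ne' (by linarith : α + recip q < 0)
  have he : 0 ≤ recip q := ENNReal.toReal_nonneg
  have hα0 : 0 < |α| := abs_pos.2 (by linarith)
  set D : ℝ := (1 + |α|) ^ |α| with hD
  have hD1 : 1 ≤ D := Real.one_le_rpow (by linarith) hα0.le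
  -- The added 1 keeps the constant positive; D passes from the logarithmic factor to the minimum.
  refine ⟨((C₁ * C₂).toReal + 1) * D, by positivity, fun ι _ _ φ M hφ hM f hf => ?_⟩
  have hM' : ∀ n, eLpNorm (φ n) ∞ unitVolume ≤ M := fun n =>
    hM ▸ le_iSup (fun n => eLpNorm (φ n) ∞ unitVolume) n
  have hM1 := one_le_of_orthonormal hφ hM'
  have hlog := Real.log_nonneg hM1
  obtain ⟨hint, hle⟩ := h₂ ι φ M hφ hM' hM1 f hf
  have hmin : (1 + Real.log M) ^ |α| ≤ D * min (M : ℝ) ((1 + Real.log M) ^ |α|) := by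
    rw [mul_min_of_nonneg _ _ (by linarith)]
    exact le_min (one_add_log_rpow_le hα0 hM1) (le_mul_of_one_le_left (by positivity) hD1)
  have hbound : max (lzSeqNorm 2 q (α + recip (max q 2)) (fourierMap φ f))
        (lzSeqNorm 2 (max q 2) (α + recip q) (fourierMap φ f)) ≤
      ENNReal.ofReal (((C₁ * C₂).toReal + 1) * D * min (M : ℝ) ((1 + Real.log M) ^ |α|)) *
        lzFunNorm 2 q (α + recip (min q 2)) f := by
    refine (h₁ ι _).trans ((mul_le_mul_right hle _).trans ?_)
    rw [← mul_assoc, ← mul_assoc]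
    gcongr
    nth_rw 1 [← ENNReal.ofReal_toReal (ENNReal.mul_ne_top hC₁ hC₂)]
    rw [← ENNReal.ofReal_mul (by positivity)]
    refine ENNReal.ofReal_le_ofReal ?_
    rw [mul_assoc (_ + 1)]
    gcongr
    linarith
  have hfin := hbound.trans_lt (ENNReal.mul_lt_top ENNReal.ofReal_lt_top hf)
  exact ⟨hint, ⟨(le_max_left _ _).trans_lt hfin, (le_max_right _ _).trans_lt hfin⟩, hbound⟩
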